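/- Let $\mathcal E^1_{\min}(\mathbb C)$ be the space of entire functions $\varphi$ with $\|\varphi\|_t:=\sup_{z\in\mathbb C}|\varphi(z)|e^{-t|z|}<\infty$ for every $t>0$, with the locally convex topology generated by the norms $\|\cdot\|_t$, $t>0$. For $h\in\mathbb C\setminus\{0\}$ put $(D_hf)(z)=(f(z+h)-f(z))/h$, and let $D_0=D$ be differentiation. Let $\sigma>0$, and let either $\alpha\ge\beta>0$ and $l=\sigma/\alpha$, or $\Re\alpha\ge0$, $\Im\alpha>0$, $\beta=\overline\alpha$ and $l=0$. Put $\lambda=\alpha+\beta$, $\eta=\alpha\beta$. Let $(s_n)_{n\ge0}$ be the monic polynomials with $s_0=1$ and $x s_n=s_{n+1}+(\lambda n+l)s_n+(\sigma n+\eta n(n-1))s_{n-1}$ for $n\ge0$ (the last term being $0$ for $n=0$), and let $\partial^-$ be the linear operator on polynomials with $\partial^-s_n=ns_{n-1}$ (and $\partial^-s_0=0$). For $\tau>0$ define measures as follows, where $(a)^{(n)}=a(a+1)\cdots(a+n-1)$ and $\operatorname{Arg}\alpha\in(0,\pi/2]$. If $\alpha=\beta>0$, $\mu_{\alpha,\alpha,\tau}(dx)=\frac{1}{\Gamma(\tau/\eta)}\alpha^{-\tau/\eta}x^{-1+\tau/\eta}e^{-x/\alpha}\,dx$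 on $(0,\infty)$. If $\alpha>\beta>0$, $\mu_{\alpha,\beta,\tau}=\big(1-\frac\beta\alpha\big)^{\tau/\eta}\sum_{n=0}^\infty\big(\frac\beta\alpha\big)^n\frac1{n!}\big(\frac\tau\eta\big)^{(n)}\delta_{(\alpha-\beta)n}$. If $\Re\alpha\ge0$, $\Im\alpha>0$, $\beta=\overline\alpha$, then on $\mathbb R$ $$\mu_{\alpha,\beta,\tau}(dx)=C_{\alpha,\beta,\tau}\exp\Big(\frac{(\frac\pi2-\operatorname{Arg}\alpha)x}{\Im\alpha}\Big)\Big|\Gamma\Big(\frac{ix}{2\Im\alpha}+\frac{i\tau\beta}{2\eta\Im\alpha}\Big)\Big|^2dx,$$ $$C_{\alpha,\beta,\tau}=\frac{(2\cos(\frac\pi2-\operatorname{Arg}\alpha))^{\tau/\eta}}{4\pi\,\Im(\alpha)\,\Gamma(\tau/\eta)}\exp\Big(\frac{(\frac\pi2-\operatorname{Arg}\alpha)\,\tau\,\Re\alpha}{\eta\,\Im\alpha}\Big).$$ Then the operator $\alpha\partial^-+1$ on polynomials has exactly one extension to a continuous linear operator $V$ in $\mathcal E^1_{\min}(\mathbb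 C)$; it satisfies $V=(1-\alpha D_{\beta-\alpha})^{-1}$, as a two-sided inverse of a continuous linear operator in $\mathcal E^1_{\min}(\mathbb C)$. For every $f\in\mathcal E^1_{\min}(\mathbb C)$ and $z\in\mathbb C$ the following holds, the integrand being integrable in each case. If $\alpha=\beta>0$, $$(Vf)(z)=\int_{(0,\infty)}f(z+x)\,\mu_{\alpha,\alpha,\eta}(dx).$$ If $\alpha>\beta>0$, $$(Vf)(z)=\int_{(\alpha-\beta)\mathbb N_0}\Big(\frac\alpha\beta f(z+x)-\frac{\alpha-\beta}\beta f(z)\Big)\mu_{\alpha,\beta,\eta}(dx).$$ If $\Re\alpha\ge0$, $\Im\alpha>0$, $\beta=\overline\alpha$, $$(Vf)(z)=\int_{\mathbb R}\Big(\frac\alpha\beta f(z+x+\beta)-\frac{\alpha-\beta}\beta f(z)\Big)\mu_{\alpha,\beta,\eta}(dx).$$ -/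

import Mathlib

open MeasureTheory Polynomial
open scoped ENNReal Polynomial

noncomputable section

namespace SegalBargmann

/-! ### The space of entire functions of order at most 1 and minimal type -/

/-- Entire functions `φ` with `sup_z |φ(z)| exp(-t|z|) < ∞` for every `t > 0`, as a vector
subspace of the space of all functions. -/
def entireMinSubmodule : Submodule ℂ (ℂ → ℂ) where
  carrier := {φ | Differentiable ℂ φ ∧
    ∀ t : ℝ, 0 < t → BddAbove (Set.range fun z : ℂ => ‖φ z‖ * Real.exp (-(t * ‖z‖)))}
  zero_mem' := by
    refine ⟨differentiable_const 0, fun t _ => ⟨0, ?_⟩⟩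
    rintro _ ⟨z, rfl⟩
    simp
  add_mem' := by
    rintro f g ⟨hf, hf'⟩ ⟨hg, hg'⟩
    refine ⟨hf.add hg, fun t ht => ?_⟩
    obtain ⟨A, hA⟩ := hf' t ht
    obtain ⟨B, hB⟩ := hg' t ht
    refine ⟨A + B, ?_⟩
    rintro _ ⟨z, rfl⟩
    have h1 := hA ⟨z, rfl⟩
    have h2 := hB ⟨z, rfl⟩
    calc ‖f z + g z‖ * Real.exp (-(t * ‖z‖))
        ≤ (‖f z‖ + ‖g z‖) * Real.exp (-(t * ‖z‖)) := by gcongr; exact norm_add_le _ _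
      _ ≤ A + B := by rw [add_mul]; exact add_le_add h1 h2
  smul_mem' := by
    rintro c f ⟨hf, hf'⟩
    refine ⟨hf.const_smul c, fun t ht => ?_⟩
    obtain ⟨A, hA⟩ := hf' t ht
    refine ⟨‖c‖ * A, ?_⟩
    rintro _ ⟨z, rfl⟩
    have h1 := hA ⟨z, rfl⟩
    calc ‖c • f z‖ * Real.exp (-(t * ‖z‖))
        = ‖c‖ * (‖f z‖ * Real.exp (-(t * ‖z‖))) := by rw [norm_smul, mul_assoc]
      _ ≤ ‖c‖ * A := mul_le_mul_of_nonneg_left h1 (norm_nonneg c)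

/-- The space `E¹_min(ℂ)`. This is a type of its own, so that it does not inherit the topology of
pointwise convergence. -/
def EMin : Type := entireMinSubmodule

namespace EMin

instance : AddCommGroup EMin := inferInstanceAs (AddCommGroup entireMinSubmodule)
instance : Module ℂ EMin := inferInstanceAs (Module ℂ entireMinSubmodule)
instance : FunLike EMin ℂ ℂ where
  coe f := f.1
  coe_injective := Subtype.val_injective

@[simp] theorem add_apply (f g : EMin) (z : ℂ) : (f + g) z = f z + g z := rfl
@[simp] theorem sub_apply (f g : EMin) (z : ℂ) : (f - g) z = f z - g z := rfl
@[simp] theorem zero_apply (z : ℂ) : (0 : EMin) z = 0 := rfl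
@[simp] theorem smul_apply (c : ℂ) (f : EMin) (z : ℂ) : (c • f) z = c * f z := rfl

@[ext] theorem ext {f g : EMin} (h : ∀ z, f z = g z) : f = g := DFunLike.ext f g h

theorem differentiable (f : EMin) : Differentiable ℂ f := f.2.1

theorem bddAbove (f : EMin) {t : ℝ} (ht : 0 < t) :
    BddAbove (Set.range fun z : ℂ => ‖f z‖ * Real.exp (-(t * ‖z‖))) := f.2.2 t ht

/-- Membership through bounds `|φ(z)| ≤ C exp(t|z|)`. -/
def mk' (φ : ℂ → ℂ) (h1 : Differentiable ℂ φ)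
    (h2 : ∀ t : ℝ, 0 < t → ∃ C : ℝ, ∀ z, ‖φ z‖ ≤ C * Real.exp (t * ‖z‖)) : EMin :=
  ⟨φ, h1, fun t ht => by
    obtain ⟨C, hC⟩ := h2 t ht
    refine ⟨C, ?_⟩
    rintro _ ⟨z, rfl⟩
    show ‖φ z‖ * Real.exp (-(t * ‖z‖)) ≤ C
    rw [Real.exp_neg, ← div_eq_mul_inv, div_le_iff₀ (Real.exp_pos _)]
    exact hC z⟩

@[simp] theorem mk'_apply (φ : ℂ → ℂ) (h1 h2) (z : ℂ) : mk' φ h1 h2 z = φ z := rfl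

/-- The norm `‖φ‖_t = sup_z |φ(z)| exp(-t|z|)`, for `t > 0`. -/
def expNorm (t : {t : ℝ // 0 < t}) : Seminorm ℂ EMin :=
  Seminorm.ofSMulLE (fun f => ⨆ z : ℂ, ‖f z‖ * Real.exp (-((t : ℝ) * ‖z‖)))
    (by simp)
    (fun f g => by
      refine ciSup_le fun z => ?_
      have h1 := le_ciSup (f.bddAbove t.2) z
      have h2 := le_ciSup (g.bddAbove t.2) z
      calc ‖(f + g) z‖ * Real.exp (-((t : ℝ) * ‖z‖))
          ≤ (‖f z‖ + ‖g z‖) * Real.exp (-((t : ℝ) * ‖z‖)) := by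
            gcongr; exact norm_add_le _ _
        _ ≤ _ := by rw [add_mul]; exact add_le_add h1 h2)
    (fun c f => by
      refine ciSup_le fun z => ?_
      have h1 := le_ciSup (f.bddAbove t.2) z
      rw [smul_apply, norm_mul, mul_assoc]
      exact mul_le_mul_of_nonneg_left h1 (norm_nonneg c))

theorem norm_apply_le (f : EMin) (t : {t : ℝ // 0 < t}) (z : ℂ) :
    ‖f z‖ ≤ expNorm t f * Real.exp ((t : ℝ) * ‖z‖) := by
  have h1 : ‖f z‖ * Real.exp (-((t : ℝ) * ‖z‖)) ≤ expNorm t f := le_ciSup (f.bddAbove t.2) z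
  rwa [Real.exp_neg, ← div_eq_mul_inv, div_le_iff₀ (Real.exp_pos _)] at h1

theorem expNorm_le {f : EMin} {t : {t : ℝ // 0 < t}} {C : ℝ}
    (h : ∀ z, ‖f z‖ ≤ C * Real.exp ((t : ℝ) * ‖z‖)) : expNorm t f ≤ C := by
  refine ciSup_le fun z => ?_
  rw [Real.exp_neg, ← div_eq_mul_inv, div_le_iff₀ (Real.exp_pos _)]
  exact h z

/-- The family of norms `‖·‖_t`, `t > 0`. -/
def expNormFamily : SeminormFamily ℂ EMin {t : ℝ // 0 < t} := expNorm

instance : Nonempty {t : ℝ // 0 < t} := ⟨⟨1, one_pos⟩⟩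

/-- The projective topology: the locally convex topology generated by all the norms `‖·‖_t`. -/
instance : TopologicalSpace EMin := expNormFamily.moduleFilterBasis.topology

theorem withSeminorms : WithSeminorms expNormFamily := ⟨rfl⟩

instance : IsTopologicalAddGroup EMin := withSeminorms.topologicalAddGroup
instance : ContinuousSMul ℂ EMin := withSeminorms.continuousSMul

/-- A linear operator bounded for each norm `‖·‖_t` is continuous. -/
def mkCLM (A : EMin →ₗ[ℂ] EMin) (C : {t : ℝ // 0 < t} → ℝ)
    (h : ∀ t f z, ‖A f z‖ ≤ C t * expNorm t f * Real.exp ((t : ℝ) * ‖z‖)) : EMin →L[ℂ] EMin :=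
  ⟨A, by
    refine withSeminorms.continuous_of_isBounded withSeminorms A ?_
    refine Seminorm.IsBounded.of_real fun t => ⟨{t}, C t, ?_⟩
    intro f
    simpa [expNormFamily] using expNorm_le (h t f)⟩

@[simp] theorem mkCLM_apply (A : EMin →ₗ[ℂ] EMin) (C h) (f : EMin) : mkCLM A C h f = A f := rfl

/-! ### Differentiation, shifts, and the `h`-derivative -/

theorem norm_deriv_le (f : EMin) (t : {t : ℝ // 0 < t}) (z : ℂ) :
    ‖deriv f z‖ ≤ Real.exp t * expNorm t f * Real.exp ((t : ℝ) * ‖z‖) := by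
  have key : ∀ w ∈ Metric.sphere z (1 : ℝ),
      ‖f w‖ ≤ Real.exp t * expNorm t f * Real.exp ((t : ℝ) * ‖z‖) := by
    intro w hw
    have hw' : ‖w‖ ≤ ‖z‖ + 1 := by
      have h1 : ‖w - z‖ = 1 := by simpa [dist_eq_norm] using hw
      calc ‖w‖ = ‖z + (w - z)‖ := by congr 1; ring
        _ ≤ ‖z‖ + ‖w - z‖ := norm_add_le _ _
        _ = ‖z‖ + 1 := by rw [h1]
    have ht : (0 : ℝ) ≤ t := t.2.le
    have hn : 0 ≤ expNorm t f := apply_nonneg _ _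
    calc ‖f w‖ ≤ expNorm t f * Real.exp ((t : ℝ) * ‖w‖) := norm_apply_le f t w
      _ ≤ expNorm t f * Real.exp ((t : ℝ) * (‖z‖ + 1)) := by gcongr
      _ = Real.exp t * expNorm t f * Real.exp ((t : ℝ) * ‖z‖) := by
          rw [mul_add, mul_one, Real.exp_add]; ring
  have := Complex.norm_deriv_le_of_forall_mem_sphere_norm_le one_pos
    f.differentiable.diffContOnCl key
  simpa using this

/-- The operator `D` of differentiation on `E¹_min(ℂ)`. -/
def derivCLM : EMin →L[ℂ] EMin :=
  mkCLM
    { toFun := fun f => mk' (deriv f)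
        (f.differentiable.contDiff.differentiable_deriv_two)
        (fun t ht => ⟨_, fun z => norm_deriv_le f ⟨t, ht⟩ z⟩)
      map_add' := fun f g => by
        ext z
        exact deriv_add (f.differentiable z) (g.differentiable z)
      map_smul' := fun c f => by
        ext z
        exact deriv_const_mul c (f.differentiable z) }
    (fun t => Real.exp t) (fun t f z => norm_deriv_le f t z)

theorem norm_shift_le (f : EMin) (h : ℂ) (t : {t : ℝ // 0 < t}) (z : ℂ) :
    ‖f (z + h)‖ ≤ Real.exp (t * ‖h‖) * expNorm t f * Real.exp ((t : ℝ) * ‖z‖) := by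
  have ht : (0 : ℝ) ≤ t := t.2.le
  have hn : 0 ≤ expNorm t f := apply_nonneg _ _
  calc ‖f (z + h)‖ ≤ expNorm t f * Real.exp ((t : ℝ) * ‖z + h‖) := norm_apply_le f t _
    _ ≤ expNorm t f * Real.exp ((t : ℝ) * (‖z‖ + ‖h‖)) := by gcongr; exact norm_add_le _ _
    _ = _ := by rw [mul_add, Real.exp_add]; ring

/-- The shift operator `f ↦ f(· + h)` on `E¹_min(ℂ)`. -/
def shiftCLM (h : ℂ) : EMin →L[ℂ] EMin :=
  mkCLM
    { toFun := fun f => mk' (fun z => f (z + h))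
        (f.differentiable.comp (differentiable_id.add_const h))
        (fun t ht => ⟨_, fun z => norm_shift_le f h ⟨t, ht⟩ z⟩)
      map_add' := fun _ _ => rfl
      map_smul' := fun _ _ => rfl }
    (fun t => Real.exp (t * ‖h‖)) (fun t f z => norm_shift_le f h t z)

/-- The operator `D_h` on `E¹_min(ℂ)`: `(D_h f)(z) = (f(z+h) - f(z))/h` for `h ≠ 0`, and
`D_0 = D` is differentiation. -/
def hDeriv (h : ℂ) : EMin →L[ℂ] EMin :=
  if h = 0 then derivCLM else h⁻¹ • (shiftCLM h - 1)

theorem hDeriv_zero_apply (f : EMin) (z : ℂ) : hDeriv 0 f z = deriv f z := by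
  simp only [hDeriv, if_true]; rfl

theorem hDeriv_apply {h : ℂ} (hh : h ≠ 0) (f : EMin) (z : ℂ) :
    hDeriv h f z = (f (z + h) - f z) / h := by
  simp only [hDeriv, if_neg hh]
  show h⁻¹ * (f (z + h) - f z) = _
  rw [div_eq_inv_mul]

/-! ### Polynomials as elements of the space -/

theorem eval_mem (p : ℂ[X]) : (fun z => p.eval z) ∈ entireMinSubmodule := by
  have hmon : ∀ n : ℕ, (fun z : ℂ => z ^ n) ∈ entireMinSubmodule := by
    intro n
    refine ⟨by fun_prop, fun t ht => ⟨(n.factorial : ℝ) / t ^ n, ?_⟩⟩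
    rintro _ ⟨z, rfl⟩
    have h1 := Real.pow_div_factorial_le_exp (t * ‖z‖) (by positivity) n
    have h2 : 0 < Real.exp (t * ‖z‖) := Real.exp_pos _
    show ‖z ^ n‖ * Real.exp (-(t * ‖z‖)) ≤ _
    rw [Real.exp_neg, ← div_eq_mul_inv, div_le_iff₀ h2, norm_pow, div_mul_eq_mul_div,
      le_div_iff₀ (by positivity)]
    rw [div_le_iff₀ (by positivity), mul_pow] at h1
    linarith
  have : (fun z => p.eval z) = ∑ i ∈ p.support, p.coeff i • fun z : ℂ => z ^ i := by
    funext z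
    simp [Polynomial.eval_eq_sum, Polynomial.sum]
  rw [this]
  exact Submodule.sum_mem _ fun i _ => Submodule.smul_mem _ _ (hmon i)

/-- The embedding of the space `P(ℂ)` of polynomials into `E¹_min(ℂ)`. -/
def ofPoly : ℂ[X] →ₗ[ℂ] EMin where
  toFun p := ⟨fun z => p.eval z, eval_mem p⟩
  map_add' p q := by ext z; exact Polynomial.eval_add
  map_smul' c p := by
    ext z
    exact Polynomial.eval_smul c p z

@[simp] theorem ofPoly_apply (p : ℂ[X]) (z : ℂ) : ofPoly p z = p.eval z := rfl

end EMin

/-! ### The Sheffer sequence and its lowering operator -/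

/-- The monic polynomials with `s_0 = 1` and
`x s_n = s_{n+1} + (λ n + l) s_n + (σ n + η n (n-1)) s_{n-1}`, where `λ = α + β`, `η = α β`. -/
def shefferPoly (α β σ l : ℂ) : ℕ → ℂ[X]
  | 0 => 1
  | 1 => X - C l
  | n + 2 => (X - C ((α + β) * (n + 1) + l)) * shefferPoly α β σ l (n + 1)
      - C (σ * (n + 1) + α * β * (n + 1) * n) * shefferPoly α β σ l n

theorem shefferPoly_monic_natDegree (α β σ l : ℂ) (n : ℕ) :
    ((shefferPoly α β σ l n).Monic ∧ (shefferPoly α β σ l n).natDegree = n) ∧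
    ((shefferPoly α β σ l (n + 1)).Monic ∧ (shefferPoly α β σ l (n + 1)).natDegree = n + 1) := by
  induction n with
  | zero =>
    refine ⟨⟨monic_one, natDegree_one⟩, ?_⟩
    simp only [shefferPoly]
    exact ⟨monic_X_sub_C l, natDegree_X_sub_C l⟩
  | succ n ih =>
    refine ⟨ih.2, ?_⟩
    obtain ⟨⟨-, hd0⟩, hm1, hd1⟩ := ih
    simp only [shefferPoly]
    set q := (X - C ((α + β) * (n + 1) + l)) * shefferPoly α β σ l (n + 1) with hq
    have hqm : q.Monic := (monic_X_sub_C _).mul hm1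
    have hqd : q.natDegree = n + 1 + 1 := by
      rw [hq, (monic_X_sub_C _).natDegree_mul hm1, natDegree_X_sub_C, hd1, add_comm]
    have hlt : (C (σ * (n + 1) + α * β * (n + 1) * n) * shefferPoly α β σ l n).degree
        < q.degree := by
      refine lt_of_le_of_lt (degree_le_natDegree) ?_
      rw [degree_eq_natDegree hqm.ne_zero, hqd, Nat.cast_lt]
      have := natDegree_C_mul_le (σ * (n + 1) + α * β * (n + 1) * n) (shefferPoly α β σ l n)
      omega
    refine ⟨hqm.sub_of_left hlt, ?_⟩
    rw [natDegree_eq_of_degree_eq (degree_sub_eq_left_of_degree_lt hlt), hqd]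

/-- The Sheffer polynomials as a polynomial sequence (`s_n` has degree `n`). -/
def shefferSeq (α β σ l : ℂ) : Polynomial.Sequence ℂ where
  elems' := shefferPoly α β σ l
  degree_eq' n := by
    have h := (shefferPoly_monic_natDegree α β σ l n).1
    rw [degree_eq_natDegree h.1.ne_zero, h.2]

theorem shefferSeq_isUnit (α β σ l : ℂ) (n : ℕ) :
    IsUnit (shefferSeq α β σ l n).leadingCoeff :=
  isUnit_iff_ne_zero.mpr (leadingCoeff_ne_zero.mpr ((shefferSeq α β σ l).ne_zero n))

/-- The lowering operator `∂⁻` on polynomials: the linear map with `∂⁻ s_n = n s_{n-1}`. -/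
def lowering (α β σ l : ℂ) : ℂ[X] →ₗ[ℂ] ℂ[X] :=
  ((shefferSeq α β σ l).basis (shefferSeq_isUnit α β σ l)).constr ℂ
    fun n => (n : ℂ) • shefferPoly α β σ l (n - 1)

theorem lowering_shefferPoly (α β σ l : ℂ) (n : ℕ) :
    lowering α β σ l (shefferPoly α β σ l n) = (n : ℂ) • shefferPoly α β σ l (n - 1) := by
  have h : shefferPoly α β σ l n
      = (shefferSeq α β σ l).basis (shefferSeq_isUnit α β σ l) n := by
    rw [Polynomial.Sequence.basis_eq_self]; rfl
  rw [h, lowering, Module.Basis.constr_basis]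

/-- The operator `V = α ∂⁻ + 1` on polynomials. -/
def vPoly (α β σ l : ℂ) : ℂ[X] →ₗ[ℂ] ℂ[X] := α • lowering α β σ l + 1

/-- A continuous linear operator in `E¹_min(ℂ)` which extends `V = α ∂⁻ + 1` from polynomials. -/
def ExtendsV (α β σ l : ℂ) (W : EMin →L[ℂ] EMin) : Prop :=
  ∀ p : ℂ[X], W (EMin.ofPoly p) = EMin.ofPoly (vPoly α β σ l p)

/-! ### The orthogonality measures -/

/-- The gamma distribution `μ_{α,α,σ}` on `(0,∞)`, where `η = α²`. -/
def gammaLaw (α σ : ℝ) : Measure ℝ :=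
  (volume.restrict (Set.Ioi 0)).withDensity fun x => ENNReal.ofReal
    (1 / Real.Gamma (σ / α ^ 2) * α ^ (-(σ / α ^ 2)) * x ^ (-1 + σ / α ^ 2) * Real.exp (-(x / α)))

/-- The negative binomial distribution `μ_{α,β,σ}` on `(α-β)ℕ₀`, where `η = αβ`. -/
def negBinomialLaw (α β σ : ℝ) : Measure ℝ :=
  Measure.sum fun n : ℕ => ENNReal.ofReal
    ((1 - β / α) ^ (σ / (α * β)) *
      ((β / α) ^ n * (1 / (n.factorial : ℝ)) * (ascPochhammer ℝ n).eval (σ / (α * β)))) •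
    Measure.dirac ((α - β) * n)

/-- The normalizing constant of the Meixner distribution, where `β = conj α` and
`η = αβ = |α|²`. -/
def meixnerConst (α : ℂ) (σ : ℝ) : ℝ :=
  (2 * Real.cos (Real.pi / 2 - α.arg)) ^ (σ / ‖α‖ ^ 2) /
    (4 * α.im * Real.pi * Real.Gamma (σ / ‖α‖ ^ 2)) *
  Real.exp ((Real.pi / 2 - α.arg) * σ * α.re / (α.im * ‖α‖ ^ 2))

/-- The Meixner distribution `μ_{α,β,σ}` on `ℝ`, where `β = conj α` and `η = αβ = |α|²`. -/
def meixnerLaw (α : ℂ) (σ : ℝ) : Measure ℝ :=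
  volume.withDensity fun x => ENNReal.ofReal
    (meixnerConst α σ * Real.exp ((Real.pi / 2 - α.arg) * x / α.im) *
      ‖Complex.Gamma (Complex.I * x / (2 * α.im)
        + Complex.I * σ * (starRingEnd ℂ) α / (2 * (‖α‖ ^ 2 : ℝ) * α.im))‖ ^ 2)

end SegalBargmann

end

open SegalBargmann

namespace SegalBargmann

namespace EMin

/-! ### Bounds in the norms `‖·‖_t` -/

/-! Cauchy's estimate bounds `D_h` in `‖·‖_t` by `e t exp(t|h|)`, which tends to 0 with `t`. So `α
D_h` contracts every norm of small index by the factor 1/2. Norms of larger index are dominated by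
these, so the Neumann series of `α D_h` defines a continuous two-sided inverse of `1 - α D_h`
(`exists_inverse_one_sub_smul_hDeriv`).

On polynomials the three-term recurrence turns, by induction, into `D ∂⁻`-algebra: with `D =
D_{β-α}` one has `D = (1 - α D) ∂⁻` (`hDeriv_shefferPoly`), hence `(1 - α D)(α ∂⁻ + 1) = 1`. The
inverse `V` of `1 - α D` therefore extends `α ∂⁻ + 1`, and it is the only continuous extension
because Taylor polynomials are dense (`tendsto_taylorPoly`).

For the integral formulas put `f = (1 - α D) g`, so that `V f = g`, and recover `g(z)` from `f`. The
measures have parameter `τ = η`, where they simplify to an exponential law, a geometric law, and an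
exponentially tilted hyperbolic secant law. In the first case the integrand is an exact derivative;
in the second the series telescopes; in the third the two shifts of `g` in `f` are the values of one
entire function on the lines `Im = ±1`, and Cauchy's theorem for `1/sinh` relates them to its value
at 0 (`integral_horizontal_eq`). Minimal type makes everything converge: the growth rate of `f` may
be taken smaller than the decay rate of the measure. -/

theorem expNorm_nonneg (t : {t : ℝ // 0 < t}) (f : EMin) : 0 ≤ expNorm t f := apply_nonneg _ _

/-- Cauchy's estimate on the circle of radius `1/t`, rather than 1, gives the factor `t` that makes
differentiation small for small `t`. -/
theorem norm_deriv_le_mul (f : EMin) (t : {t : ℝ // 0 < t}) (z : ℂ) :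
    ‖deriv f z‖ ≤ Real.exp 1 * t * expNorm t f * Real.exp ((t : ℝ) * ‖z‖) := by
  have ht : (0 : ℝ) < t := t.2
  have key : ∀ w ∈ Metric.sphere z (t : ℝ)⁻¹,
      ‖f w‖ ≤ Real.exp 1 * expNorm t f * Real.exp ((t : ℝ) * ‖z‖) := by
    intro w hw
    have h1 : ‖w - z‖ = (t : ℝ)⁻¹ := by simpa [dist_eq_norm] using hw
    have h2 := norm_shift_le f (w - z) t z
    rwa [h1, mul_inv_cancel₀ ht.ne', add_sub_cancel] at h2
  refine (Complex.norm_deriv_le_of_forall_mem_sphere_norm_le (inv_pos.mpr ht)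
    f.differentiable.diffContOnCl key).trans (le_of_eq ?_)
  field_simp

theorem norm_shift_sub_le (f : EMin) (h : ℂ) (t : {t : ℝ // 0 < t}) (z : ℂ) :
    ‖f (z + h) - f z‖ ≤
      Real.exp 1 * t * Real.exp (t * ‖h‖) * expNorm t f * Real.exp ((t : ℝ) * ‖z‖) * ‖h‖ := by
  have ht : (0 : ℝ) ≤ t := t.2.le
  have hn := expNorm_nonneg t f
  have hmv := (convex_closedBall z ‖h‖).norm_image_sub_le_of_norm_deriv_le (𝕜 := ℂ) (f := f)
    (C := Real.exp 1 * t * Real.exp (t * ‖h‖) * expNorm t f * Real.exp ((t : ℝ) * ‖z‖))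
    (x := z) (y := z + h) (fun w _ => f.differentiable w) ?_ (by simp) (by simp)
  · simpa using hmv
  · intro w hw
    have hw' : ‖w‖ ≤ ‖z‖ + ‖h‖ := by
      have h1 : ‖w - z‖ ≤ ‖h‖ := by simpa [dist_eq_norm] using hw
      have h2 := norm_le_norm_add_norm_sub' w z
      linarith
    calc ‖deriv f w‖ ≤ Real.exp 1 * t * expNorm t f * Real.exp ((t : ℝ) * ‖w‖) :=
          norm_deriv_le_mul f t w
      _ ≤ Real.exp 1 * t * expNorm t f * Real.exp ((t : ℝ) * (‖z‖ + ‖h‖)) := by gcongr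
      _ = _ := by rw [mul_add, Real.exp_add]; ring

theorem expNorm_hDeriv_le (h : ℂ) (f : EMin) (t : {t : ℝ // 0 < t}) :
    expNorm t (hDeriv h f) ≤ Real.exp 1 * t * Real.exp (t * ‖h‖) * expNorm t f := by
  refine expNorm_le fun z => ?_
  by_cases hh : h = 0
  · subst hh
    rw [hDeriv_zero_apply]
    simpa using norm_deriv_le_mul f t z
  · rw [hDeriv_apply hh, norm_div, div_le_iff₀ (norm_pos_iff.mpr hh)]
    exact norm_shift_sub_le f h t z

/-! ### Continuity of evaluation, separation -/

theorem eq_of_expNorm_sub_eq_zero {f g : EMin} {t : {t : ℝ // 0 < t}}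
    (h : expNorm t (f - g) = 0) : f = g := by
  ext z
  have := norm_apply_le (f - g) t z
  rw [h, zero_mul] at this
  simpa [sub_eq_zero] using norm_le_zero_iff.mp this

/-- A topological group that is T1 is Hausdorff; limits of Taylor polynomials are then unique. -/
instance : T1Space EMin :=
  withSeminorms.T1_of_separating fun f hf => ⟨⟨1, one_pos⟩, fun h =>
    hf (eq_of_expNorm_sub_eq_zero (t := ⟨1, one_pos⟩) (by rw [sub_zero]; exact h))⟩

/-! ### Neumann series of operators which are small for the norms of small index -/

section Neumann

variable {B : EMin →L[ℂ] EMin} {s : {t : ℝ // 0 < t}}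

theorem expNorm_pow_apply_le
    (hB : ∀ t ≤ s, ∀ f, expNorm t (B f) ≤ 1 / 2 * expNorm t f)
    {t : {t : ℝ // 0 < t}} (ht : t ≤ s) (f : EMin) (n : ℕ) :
    expNorm t ((B ^ n) f) ≤ (1 / 2) ^ n * expNorm t f := by
  induction n with
  | zero => simp
  | succ n ih =>
    rw [pow_succ' B n, mul_apply_eq_comp]
    refine (hB t ht _).trans ?_
    rw [pow_succ']
    linarith

theorem norm_pow_apply_le
    (hB : ∀ t ≤ s, ∀ f, expNorm t (B f) ≤ 1 / 2 * expNorm t f)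
    {t : {t : ℝ // 0 < t}} (ht : t ≤ s) (f : EMin) (n : ℕ) (z : ℂ) :
    ‖(B ^ n) f z‖ ≤ (1 / 2) ^ n * (expNorm t f * Real.exp (t * ‖z‖)) := by
  refine (norm_apply_le _ t z).trans ?_
  rw [← mul_assoc]
  gcongr
  exact expNorm_pow_apply_le hB ht f n

theorem summable_neumann
    (hB : ∀ t ≤ s, ∀ f, expNorm t (B f) ≤ 1 / 2 * expNorm t f) (f : EMin) (z : ℂ) :
    Summable fun n => (B ^ n) f z :=
  Summable.of_norm_bounded (summable_geometric_two.mul_right _)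
    fun n => norm_pow_apply_le hB le_rfl f n z

theorem norm_tsum_neumann_le
    (hB : ∀ t ≤ s, ∀ f, expNorm t (B f) ≤ 1 / 2 * expNorm t f)
    {t : {t : ℝ // 0 < t}} (ht : t ≤ s) (f : EMin) (z : ℂ) :
    ‖∑' n, (B ^ n) f z‖ ≤ 2 * expNorm t f * Real.exp (t * ‖z‖) := by
  have := tsum_of_norm_bounded (summable_geometric_two.hasSum.mul_right _)
    fun n => norm_pow_apply_le hB ht f n z
  rwa [tsum_geometric_two, ← mul_assoc] at this

theorem differentiable_tsum_neumann
    (hB : ∀ t ≤ s, ∀ f, expNorm t (B f) ≤ 1 / 2 * expNorm t f) (f : EMin) :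
    Differentiable ℂ fun z => ∑' n, (B ^ n) f z := by
  intro z
  have := Complex.differentiableOn_tsum_of_summable_norm (F := fun n => ((B ^ n) f : ℂ → ℂ))
    (U := Metric.ball 0 (‖z‖ + 1))
    (u := fun n => (1 / 2) ^ n * (expNorm s f * Real.exp (s * (‖z‖ + 1))))
    (summable_geometric_two.mul_right _)
    (fun n => ((B ^ n) f).differentiable.differentiableOn) Metric.isOpen_ball ?_
  · exact this.differentiableAt (Metric.isOpen_ball.mem_nhds (by simp))
  · intro n w hw
    have hw' : ‖w‖ ≤ ‖z‖ + 1 := by simpa using (Metric.mem_ball.mp hw).le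
    refine (norm_pow_apply_le hB le_rfl f n w).trans ?_
    have := expNorm_nonneg s f
    have hs : (0 : ℝ) ≤ s := s.2.le
    gcongr

/-- For `t > s` the operator `B` need not contract `‖·‖_t`, but the bound in `‖·‖_s` suffices since
`exp(s|z|) ≤ exp(t|z|)`. Continuity of the sum thus compares `‖·‖_t` with a norm of possibly
different index. -/
theorem norm_tsum_neumann_le_min
    (hB : ∀ t ≤ s, ∀ f, expNorm t (B f) ≤ 1 / 2 * expNorm t f)
    (t : {t : ℝ // 0 < t}) (f : EMin) (z : ℂ) :
    ‖∑' n, (B ^ n) f z‖ ≤ 2 * expNorm (min t s) f * Real.exp (t * ‖z‖) := by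
  refine (norm_tsum_neumann_le hB (min_le_right t s) f z).trans ?_
  have h : ((min t s : {t : ℝ // 0 < t}) : ℝ) ≤ t := min_le_left t s
  have := expNorm_nonneg (min t s) f
  gcongr

/-- The sum of the Neumann series `∑ Bⁿ`, as a linear map. -/
noncomputable def neumannLinear
    (hB : ∀ t ≤ s, ∀ f, expNorm t (B f) ≤ 1 / 2 * expNorm t f) : EMin →ₗ[ℂ] EMin where
  toFun f := mk' (fun z => ∑' n, (B ^ n) f z) (differentiable_tsum_neumann hB f)
    fun t ht => ⟨_, norm_tsum_neumann_le_min hB ⟨t, ht⟩ f⟩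
  map_add' f g := by
    ext z
    simpa using (summable_neumann hB f z).tsum_add (summable_neumann hB g z)
  map_smul' c f := by
    ext z
    simp [tsum_mul_left]

/-- The sum of the Neumann series `∑ Bⁿ`. -/
noncomputable def neumann (hB : ∀ t ≤ s, ∀ f, expNorm t (B f) ≤ 1 / 2 * expNorm t f) :
    EMin →L[ℂ] EMin :=
  ⟨neumannLinear hB, by
    refine withSeminorms.continuous_of_isBounded withSeminorms (neumannLinear hB) ?_
    refine Seminorm.IsBounded.of_real fun t => ⟨{min t s}, 2, fun f => ?_⟩
    simpa [expNormFamily] using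
      expNorm_le (f := neumannLinear hB f) (norm_tsum_neumann_le_min hB t f)⟩

theorem neumann_apply (hB : ∀ t ≤ s, ∀ f, expNorm t (B f) ≤ 1 / 2 * expNorm t f)
    (f : EMin) (z : ℂ) : neumann hB f z = ∑' n, (B ^ n) f z := rfl

theorem neumann_eq_add (hB : ∀ t ≤ s, ∀ f, expNorm t (B f) ≤ 1 / 2 * expNorm t f) (f : EMin) :
    neumann hB f = f + neumann hB (B f) := by
  ext z
  rw [add_apply, neumann_apply, (summable_neumann hB f z).tsum_eq_zero_add, neumann_apply]
  rfl

theorem expNorm_neumann_le (hB : ∀ t ≤ s, ∀ f, expNorm t (B f) ≤ 1 / 2 * expNorm t f)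
    (f : EMin) : expNorm s (neumann hB f) ≤ 2 * expNorm s f :=
  expNorm_le (norm_tsum_neumann_le hB le_rfl f)

/-- Write `N` for the sum. By `N f = f + N(B f)`, the defect `B N f - N B f` does not change when
`f` is replaced by `B f`, hence by `Bⁿ f`. Its norm is then at most a constant times `2⁻ⁿ`, so it
vanishes. No convergence of the series in the topology of the space is needed. -/
theorem neumann_comm_apply (hB : ∀ t ≤ s, ∀ f, expNorm t (B f) ≤ 1 / 2 * expNorm t f) (f : EMin) :
    B (neumann hB f) = neumann hB (B f) := by
  have hsplit : ∀ (n : ℕ) (f : EMin), expNorm s (B (neumann hB f) - neumann hB (B f))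
      = expNorm s (B (neumann hB ((B ^ n) f)) - neumann hB (B ((B ^ n) f))) := by
    intro n
    induction n with
    | zero => intro f; simp
    | succ n ih =>
      intro f
      rw [ih f, pow_succ' B n, mul_apply_eq_comp]
      have h1 := congrArg B (neumann_eq_add hB ((B ^ n) f))
      have h2 := neumann_eq_add hB (B ((B ^ n) f))
      rw [map_add] at h1
      rw [h1]
      nth_rewrite 2 [h2]
      rw [add_sub_add_left_eq_sub]
  have hbound : ∀ n : ℕ, expNorm s (B (neumann hB f) - neumann hB (B f))
      ≤ (1 / 2) ^ n * (2 * expNorm s f) := by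
    intro n
    rw [hsplit n f]
    have h1 := hB s le_rfl (neumann hB ((B ^ n) f))
    have h2 := expNorm_neumann_le hB ((B ^ n) f)
    have h3 := expNorm_neumann_le hB (B ((B ^ n) f))
    have h4 := hB s le_rfl ((B ^ n) f)
    have h5 := expNorm_pow_apply_le hB le_rfl f n
    have h6 := map_sub_le_add (expNorm s) (B (neumann hB ((B ^ n) f)))
      (neumann hB (B ((B ^ n) f)))
    linarith
  have hlim := (tendsto_pow_atTop_nhds_zero_of_lt_one (r := (1 / 2 : ℝ)) (by norm_num)
    (by norm_num)).mul_const (2 * expNorm s f)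
  rw [zero_mul] at hlim
  exact eq_of_expNorm_sub_eq_zero (le_antisymm (ge_of_tendsto' hlim hbound) (expNorm_nonneg _ _))

theorem neumann_mul_one_sub (hB : ∀ t ≤ s, ∀ f, expNorm t (B f) ≤ 1 / 2 * expNorm t f) :
    neumann hB * (1 - B) = 1 := by
  refine ContinuousLinearMap.ext fun f => ?_
  show neumann hB (f - B f) = f
  rw [map_sub, sub_eq_iff_eq_add]
  exact neumann_eq_add hB f

theorem one_sub_mul_neumann (hB : ∀ t ≤ s, ∀ f, expNorm t (B f) ≤ 1 / 2 * expNorm t f) :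
    (1 - B) * neumann hB = 1 := by
  refine ContinuousLinearMap.ext fun f => ?_
  show neumann hB f - B (neumann hB f) = f
  rw [neumann_comm_apply, sub_eq_iff_eq_add]
  exact neumann_eq_add hB f

end Neumann

/-- The bound `|α| e t exp(t|h|)` for `α D_h` in `‖·‖_t` is continuous in `t` and vanishes at `t =
0`, so it is below 1/2 for all small `t` and the Neumann series applies. -/
theorem exists_inverse_one_sub_smul_hDeriv (α h : ℂ) : ∃ V : EMin →L[ℂ] EMin,
    V * (1 - α • hDeriv h) = 1 ∧ (1 - α • hDeriv h) * V = 1 := by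
  obtain ⟨s, hs⟩ : ∃ s : {t : ℝ // 0 < t}, ∀ t ≤ s,
      ‖α‖ * (Real.exp 1 * (t : ℝ) * Real.exp (t * ‖h‖)) ≤ 1 / 2 := by
    have hc : Continuous fun t : ℝ => ‖α‖ * (Real.exp 1 * t * Real.exp (t * ‖h‖)) := by fun_prop
    have h0 : ∀ᶠ t in nhds (0 : ℝ), ‖α‖ * (Real.exp 1 * t * Real.exp (t * ‖h‖)) < 1 / 2 :=
      hc.continuousAt.eventually_lt continuousAt_const (by simp)
    obtain ⟨ε, hε, hε'⟩ := Metric.eventually_nhds_iff.mp h0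
    refine ⟨⟨ε / 2, half_pos hε⟩, fun t ht => (hε' ?_).le⟩
    have ht' : (t : ℝ) ≤ ε / 2 := ht
    have := t.2
    rw [Real.dist_eq, sub_zero, abs_of_pos this]
    linarith
  have hB : ∀ t ≤ s, ∀ f, expNorm t ((α • hDeriv h) f) ≤ 1 / 2 * expNorm t f := by
    intro t ht f
    show expNorm t (α • hDeriv h f) ≤ _
    rw [map_smul_eq_mul]
    have h1 := expNorm_hDeriv_le h f t
    calc ‖α‖ * expNorm t (hDeriv h f)
        ≤ ‖α‖ * (Real.exp 1 * t * Real.exp (t * ‖h‖) * expNorm t f) := by gcongr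
      _ = ‖α‖ * (Real.exp 1 * t * Real.exp (t * ‖h‖)) * expNorm t f := by ring
      _ ≤ _ := mul_le_mul_of_nonneg_right (hs t ht) (expNorm_nonneg t f)
  exact ⟨neumann hB, neumann_mul_one_sub hB, one_sub_mul_neumann hB⟩

/-! ### Density of the polynomials -/

/-- Cauchy's estimate measured in a norm of smaller index `s` beats the growth of `|z|ⁿ / n!`
measured in `‖·‖_t`: the quotient of consecutive bounds is `e s / t = 1/2`. -/
theorem norm_taylor_term_le (f : EMin) {s t : {t : ℝ // 0 < t}}
    (hst : Real.exp 1 * (s : ℝ) = t / 2) (n : ℕ) (z : ℂ) :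
    ‖(n.factorial : ℂ)⁻¹ • (z - 0) ^ n • iteratedDeriv n f 0‖
      ≤ (1 / 2) ^ n * (Real.exp 1 * expNorm s f * Real.exp (t * ‖z‖)) := by
  have hs := s.2
  have ht := t.2
  have hf := expNorm_nonneg s f
  have hfac : (0 : ℝ) < n.factorial := by positivity
  have h1 : ‖iteratedDeriv n f 0‖ ≤ n.factorial *
      (expNorm s f * Real.exp (n + 1)) / ((n + 1) / s) ^ n := by
    -- The near-optimal radius is `n / s`; `n + 1` keeps it positive for `n = 0`, at the cost of one
    -- factor `e`.
    refine Complex.norm_iteratedDeriv_le_of_forall_mem_sphere_norm_le n (by positivity)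
      f.differentiable.diffContOnCl fun w hw => ?_
    have hw' : ‖w‖ = (n + 1) / s := by simpa using hw
    have := norm_apply_le f s w
    rwa [hw', mul_div_cancel₀ _ hs.ne'] at this
  have h2 : ‖z‖ ^ n ≤ n.factorial * Real.exp (t * ‖z‖) / (t : ℝ) ^ n := by
    have := Real.pow_div_factorial_le_exp (t * ‖z‖) (by positivity) n
    rw [div_le_iff₀ hfac, mul_pow] at this
    rw [le_div_iff₀ (by positivity)]
    linarith
  have h3 : (n.factorial : ℝ) ≤ ((n : ℝ) + 1) ^ n := by
    have h : n.factorial ≤ (n + 1) ^ n :=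
      n.factorial_le_pow.trans (Nat.pow_le_pow_left n.le_succ n)
    exact_mod_cast h
  rw [sub_zero, norm_smul, norm_smul, norm_inv, norm_pow, Complex.norm_natCast]
  calc (n.factorial : ℝ)⁻¹ * (‖z‖ ^ n * ‖iteratedDeriv n f 0‖)
      ≤ (n.factorial : ℝ)⁻¹ * ((n.factorial * Real.exp (t * ‖z‖) / (t : ℝ) ^ n) *
        (n.factorial * (expNorm s f * Real.exp (n + 1)) / ((n + 1) / s) ^ n)) := by gcongr
    _ = (n.factorial / ((n : ℝ) + 1) ^ n) * (Real.exp 1 * s / t) ^ n *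
        (Real.exp 1 * expNorm s f * Real.exp (t * ‖z‖)) := by
          rw [Real.exp_add, ← mul_one (n : ℝ), Real.exp_nat_mul, mul_one, div_pow, div_pow, mul_pow]
          field_simp
    _ ≤ 1 * (Real.exp 1 * s / t) ^ n *
        (Real.exp 1 * expNorm s f * Real.exp (t * ‖z‖)) := by
          gcongr
          exact div_le_one_of_le₀ h3 (by positivity)
    _ = _ := by
          rw [hst, one_mul]
          congr 2
          field_simp

/-- The Taylor polynomials at the origin. -/
noncomputable def taylorPoly (f : EMin) (N : ℕ) : ℂ[X] :=
  ∑ n ∈ Finset.range N, C ((n.factorial : ℂ)⁻¹ * iteratedDeriv n f 0) * X ^ n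

theorem expNorm_taylorPoly_sub_le (f : EMin) {s t : {t : ℝ // 0 < t}}
    (hst : Real.exp 1 * (s : ℝ) = t / 2) (N : ℕ) :
    expNorm t (ofPoly (taylorPoly f N) - f) ≤ (1 / 2) ^ N * (2 * (Real.exp 1 * expNorm s f)) := by
  refine expNorm_le fun z => ?_
  have hsum := Complex.hasSum_taylorSeries_of_entire f.differentiable 0 z
  have htail := hsum.summable.sum_add_tsum_nat_add N
  rw [hsum.tsum_eq] at htail
  have hpoly : ofPoly (taylorPoly f N) z
      = ∑ n ∈ Finset.range N, (n.factorial : ℂ)⁻¹ • (z - 0) ^ n • iteratedDeriv n f 0 := by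
    rw [ofPoly_apply, taylorPoly, eval_finsetSum]
    refine Finset.sum_congr rfl fun n _ => ?_
    simp only [eval_mul, eval_C, eval_pow, eval_X, smul_eq_mul, sub_zero]
    ring
  rw [sub_apply, hpoly, ← htail, sub_add_cancel_left, norm_neg]
  refine (tsum_of_norm_bounded (summable_geometric_two.hasSum.mul_right
    ((1 / 2) ^ N * (Real.exp 1 * expNorm s f * Real.exp (t * ‖z‖)))) fun n => ?_).trans
    (le_of_eq ?_)
  · refine (norm_taylor_term_le f hst (n + N) z).trans (le_of_eq ?_)
    rw [pow_add, mul_assoc]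
  · rw [tsum_geometric_two]
    ring

theorem tendsto_taylorPoly (f : EMin) :
    Filter.Tendsto (fun N => ofPoly (taylorPoly f N)) Filter.atTop (nhds f) := by
  rw [withSeminorms.tendsto_nhds]
  intro t ε hε
  have hs : 0 < (t : ℝ) / 2 / Real.exp 1 := by have := t.2; positivity
  have hlim := (tendsto_pow_atTop_nhds_zero_of_lt_one (r := (1 / 2 : ℝ)) (by norm_num)
    (by norm_num)).mul_const (2 * (Real.exp 1 * expNorm ⟨_, hs⟩ f))
  rw [zero_mul] at hlim
  filter_upwards [hlim.eventually_lt_const hε] with N hN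
  exact (expNorm_taylorPoly_sub_le f (s := ⟨_, hs⟩)
    (mul_div_cancel₀ _ (Real.exp_pos 1).ne') N).trans_lt hN

theorem clm_ext_ofPoly {V W : EMin →L[ℂ] EMin} (h : ∀ p, V (ofPoly p) = W (ofPoly p)) : V = W := by
  refine ContinuousLinearMap.ext fun f => ?_
  have h1 := (V.continuous.tendsto f).comp (tendsto_taylorPoly f)
  have h2 := (W.continuous.tendsto f).comp (tendsto_taylorPoly f)
  refine tendsto_nhds_unique h1 (h2.congr fun N => (h _).symm)

/-! ### The `h`-derivative of the Sheffer polynomials -/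

/-- The twisted Leibniz rule for multiplication by `X`, which lets `D_h` pass through the three-term
recurrence. -/
theorem hDeriv_ofPoly_X_mul (h : ℂ) (p : ℂ[X]) (z : ℂ) :
    hDeriv h (ofPoly (X * p)) z = (z + h) * hDeriv h (ofPoly p) z + p.eval z := by
  by_cases hh : h = 0
  · subst hh
    have hd : ∀ q : ℂ[X], hDeriv 0 (ofPoly q) z = q.derivative.eval z := fun q => by
      rw [hDeriv_zero_apply]
      exact q.deriv
    rw [hd, hd, derivative_mul, derivative_X]
    simp
    ring
  · rw [hDeriv_apply hh, hDeriv_apply hh]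
    simp only [ofPoly_apply, eval_mul, eval_X]
    field_simp
    ring

theorem hDeriv_one (h : ℂ) (z : ℂ) : hDeriv h (ofPoly 1) z = 0 := by
  by_cases hh : h = 0
  · subst hh
    rw [hDeriv_zero_apply]
    have : (ofPoly 1 : ℂ → ℂ) = fun _ => 1 := by funext w; simp
    rw [this, deriv_const]
  · simp [hDeriv_apply hh]

/-- This is `D s_{n+1} = (1 - α D) ∂⁻ s_{n+1}` for `D = D_{β-α}`. Applying `D` to the recurrence
gives a recurrence for `D s_n` which, thanks to `λ = α + β` and `η = αβ`, the right-hand side also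
satisfies. -/
theorem hDeriv_shefferPoly (α β σ l : ℂ) (n : ℕ) (z : ℂ) :
    hDeriv (β - α) (ofPoly (shefferPoly α β σ l (n + 1))) z =
      (n + 1) * ((shefferPoly α β σ l n).eval z
        - α * hDeriv (β - α) (ofPoly (shefferPoly α β σ l n)) z) := by
  have hmul : ∀ (c : ℂ) (p : ℂ[X]), hDeriv (β - α) (ofPoly (C c * p)) z
      = c * hDeriv (β - α) (ofPoly p) z := fun c p => by
    rw [← smul_eq_C_mul, map_smul, map_smul, smul_apply]
  have hrec : ∀ n, hDeriv (β - α) (ofPoly (shefferPoly α β σ l (n + 2))) z =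
      (z + (β - α)) * hDeriv (β - α) (ofPoly (shefferPoly α β σ l (n + 1))) z
      + (shefferPoly α β σ l (n + 1)).eval z
      - ((α + β) * (n + 1) + l) * hDeriv (β - α) (ofPoly (shefferPoly α β σ l (n + 1))) z
      - (σ * (n + 1) + α * β * (n + 1) * n)
        * hDeriv (β - α) (ofPoly (shefferPoly α β σ l n)) z := by
    intro n
    rw [shefferPoly, sub_mul, map_sub, map_sub, map_sub, map_sub, sub_apply, sub_apply, hmul, hmul,
      hDeriv_ofPoly_X_mul]
  have hS : ∀ n, (shefferPoly α β σ l (n + 2)).eval z =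
      (z - ((α + β) * (n + 1) + l)) * (shefferPoly α β σ l (n + 1)).eval z
      - (σ * (n + 1) + α * β * (n + 1) * n) * (shefferPoly α β σ l n).eval z := by
    intro n
    rw [shefferPoly]
    simp only [eval_sub, eval_mul, eval_X, eval_C]
  have h0 : hDeriv (β - α) (ofPoly (shefferPoly α β σ l 0)) z = 0 := hDeriv_one _ z
  have h1 : hDeriv (β - α) (ofPoly (shefferPoly α β σ l 1)) z = 1 := by
    have : shefferPoly α β σ l 1 = X * 1 - C l * 1 := by simp [shefferPoly]
    rw [this, map_sub, map_sub, sub_apply, hmul, hDeriv_ofPoly_X_mul, hDeriv_one]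
    simp
  have hS0 : (shefferPoly α β σ l 0).eval z = 1 := by simp [shefferPoly]
  have hS1 : (shefferPoly α β σ l 1).eval z = z - l := by simp [shefferPoly]
  induction n using Nat.twoStepInduction with
  | zero => rw [zero_add, h1, h0, hS0]; simp
  | one =>
    have := hrec 0
    rw [h0, zero_add, h1, hS1] at this
    rw [one_add_one_eq_two, h1, hS1, this]
    push_cast
    ring
  | more m ih0 ih1 =>
    have r1 := hrec (m + 1)
    have r0 := hrec m
    have s0 := hS m
    push_cast at r1 r0 s0 ih0 ih1 ⊢
    -- `r1` expands the left side. One `-α D s_{m+2}` is kept for the goal, which is why `ih1`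
    -- carries the extra `+ α`; the rest is rewritten by `ih1` and collected by `r0`, `s0` and
    -- `ih0`. The surplus `αβ (m+2) D s_{m+1}` accounts for the step from `η m` to `η (m+1)`.
    linear_combination r1 + (z + (β - α) - (α + β) * (m + 2) - l + α) * ih1
      + (m + 2) * α * r0 - (m + 2) * s0 - (m + 2) * (σ + α * β * m) * ih0

/-- From `(1 - α D) ∂⁻ = D` follows `(1 - α D)(α ∂⁻ + 1) = α D + 1 - α D = 1`. -/
theorem one_sub_smul_hDeriv_vPoly (α β σ l : ℂ) (p : ℂ[X]) :
    (1 - α • hDeriv (β - α)) (ofPoly (vPoly α β σ l p)) = ofPoly p := by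
  have key : ((1 - α • hDeriv (β - α) : EMin →L[ℂ] EMin) : EMin →ₗ[ℂ] EMin) ∘ₗ ofPoly ∘ₗ
      vPoly α β σ l = ofPoly := by
    refine ((shefferSeq α β σ l).basis (shefferSeq_isUnit α β σ l)).ext fun n => ?_
    rw [Polynomial.Sequence.basis_eq_self]
    show (1 - α • hDeriv (β - α)) (ofPoly (vPoly α β σ l (shefferPoly α β σ l n)))
      = ofPoly (shefferPoly α β σ l n)
    have hv : vPoly α β σ l (shefferPoly α β σ l n)
        = α • (n : ℂ) • shefferPoly α β σ l (n - 1) + shefferPoly α β σ l n := by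
      rw [← lowering_shefferPoly]; rfl
    rw [hv, map_add, map_smul, map_smul]
    ext z
    show α * (n * (shefferPoly α β σ l (n - 1)).eval z) + (shefferPoly α β σ l n).eval z
      - α * hDeriv (β - α) (α • (n : ℂ) • ofPoly (shefferPoly α β σ l (n - 1))
        + ofPoly (shefferPoly α β σ l n)) z = (shefferPoly α β σ l n).eval z
    rw [map_add, map_smul, map_smul, add_apply, smul_apply, smul_apply]
    cases n with
    | zero => simp [shefferPoly, hDeriv_one]
    | succ n =>
      rw [hDeriv_shefferPoly, Nat.add_sub_cancel]
      push_cast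
      ring
  exact LinearMap.congr_fun key p

/-! ### Identification of the unique extension with the inverse -/

theorem extendsV_iff {α β σ l : ℂ} {V : EMin →L[ℂ] EMin}
    (hV : V * (1 - α • hDeriv (β - α)) = 1) (W : EMin →L[ℂ] EMin) :
    ExtendsV α β σ l W ↔ W = V := by
  have hVp : ExtendsV α β σ l V := fun p => by
    have := congrArg V (one_sub_smul_hDeriv_vPoly α β σ l p)
    rw [← this, ← mul_apply_eq_comp, hV]
    rfl
  refine ⟨fun hW => clm_ext_ofPoly fun p => ?_, fun h => h ▸ hVp⟩
  rw [hW p, hVp p]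

/-- The inverse of `1 - α D_{β-α}` extends `α ∂⁻ + 1`; a formula for the functionals
`f ↦ (V f)(z)` needs to be checked only on the functions `f = (1 - α D_{β-α}) g`. -/
theorem exists_extension_of_forall (α β σ l : ℂ) (P : EMin → ℂ → ℂ → Prop)
    (hP : ∀ (g : EMin) (z : ℂ), P ((1 - α • hDeriv (β - α)) g) z (g z)) :
    ∃ V : EMin →L[ℂ] EMin,
      (∀ W : EMin →L[ℂ] EMin, ExtendsV α β σ l W ↔ W = V) ∧
      V * (1 - α • hDeriv (β - α)) = 1 ∧ (1 - α • hDeriv (β - α)) * V = 1 ∧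
      ∀ (f : EMin) (z : ℂ), P f z (V f z) := by
  obtain ⟨V, h1, h2⟩ := exists_inverse_one_sub_smul_hDeriv α (β - α)
  refine ⟨V, extendsV_iff h1, h1, h2, fun f z => ?_⟩
  have := hP (V f) z
  rwa [← mul_apply_eq_comp, h2] at this

end EMin

open EMin

/-! ### Integration against measures with a real density -/

theorem integrable_withDensity_ofReal_iff {μ : Measure ℝ} {w : ℝ → ℝ} (hw : Measurable w)
    (hw0 : ∀ x, 0 ≤ w x) {f : ℝ → ℂ} :
    Integrable f (μ.withDensity fun x => ENNReal.ofReal (w x)) ↔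
      Integrable (fun x => (w x : ℂ) * f x) μ := by
  rw [integrable_withDensity_iff_integrable_smul' hw.ennreal_ofReal (by simp)]
  simp only [ENNReal.toReal_ofReal (hw0 _), Complex.real_smul]

theorem integral_withDensity_ofReal {μ : Measure ℝ} {w : ℝ → ℝ} (hw : Measurable w)
    (hw0 : ∀ x, 0 ≤ w x) (f : ℝ → ℂ) :
    ∫ x, f x ∂(μ.withDensity fun x => ENNReal.ofReal (w x)) = ∫ x, (w x : ℂ) * f x ∂μ := by
  rw [integral_withDensity_eq_integral_toReal_smul hw.ennreal_ofReal (by simp)]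
  simp only [ENNReal.toReal_ofReal (hw0 _), Complex.real_smul]

/-! ### The exponential distribution -/

theorem gammaLaw_sq {α : ℝ} (hα : 0 < α) : gammaLaw α (α ^ 2) =
    (volume.restrict (Set.Ioi 0)).withDensity
      fun x => ENNReal.ofReal (α⁻¹ * Real.exp (-α⁻¹ * x)) := by
  have h : α ^ 2 / α ^ 2 = 1 := div_self (by positivity)
  unfold gammaLaw
  congr 1
  funext x
  rw [h, Real.Gamma_one, Real.rpow_neg_one, neg_add_cancel, Real.rpow_zero, div_one, one_mul,
    mul_one, div_eq_inv_mul, neg_mul]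

/-- Bounding `f` in the norm of index `c/2` leaves half of the exponential decay. -/
theorem norm_exp_mul_shift_le (f : EMin) (z : ℂ) {c : ℝ} (hc : 0 < c) {x : ℝ} (hx : 0 ≤ x) :
    ‖(Real.exp (-c * x) : ℂ) * f (z + x)‖ ≤
      Real.exp (-(c / 2) * x) * (expNorm ⟨c / 2, half_pos hc⟩ f * Real.exp (c / 2 * ‖z‖)) := by
  have h1 := norm_shift_le f x ⟨c / 2, half_pos hc⟩ z
  rw [Complex.norm_real, Real.norm_of_nonneg hx] at h1
  rw [norm_mul, Complex.norm_real, Real.norm_of_nonneg (Real.exp_pos _).le]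
  refine (mul_le_mul_of_nonneg_left h1 (Real.exp_pos _).le).trans (le_of_eq ?_)
  have : Real.exp (-c * x) * Real.exp (c / 2 * x) = Real.exp (-(c / 2) * x) := by
    rw [← Real.exp_add]; ring_nf
  rw [← this]
  ring

theorem integrableOn_exp_mul_shift (f : EMin) (z : ℂ) {c : ℝ} (hc : 0 < c) :
    IntegrableOn (fun x : ℝ => (Real.exp (-c * x) : ℂ) * f (z + x)) (Set.Ioi 0) := by
  refine Integrable.mono' ((exp_neg_integrableOn_Ioi 0 (half_pos hc)).mul_const
    (expNorm ⟨c / 2, half_pos hc⟩ f * Real.exp (c / 2 * ‖z‖))) ?_ ?_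
  · have := f.differentiable.continuous
    exact Continuous.aestronglyMeasurable (by fun_prop)
  · exact (ae_restrict_iff' measurableSet_Ioi).mpr
      (ae_of_all _ fun x hx => norm_exp_mul_shift_le f z hc (le_of_lt hx))

theorem tendsto_exp_mul_shift (f : EMin) (z : ℂ) {c : ℝ} (hc : 0 < c) :
    Filter.Tendsto (fun x : ℝ => (Real.exp (-c * x) : ℂ) * f (z + x)) Filter.atTop (nhds 0) := by
  have hlim : Filter.Tendsto (fun x : ℝ => Real.exp (-(c / 2) * x) *
      (expNorm ⟨c / 2, half_pos hc⟩ f * Real.exp (c / 2 * ‖z‖))) Filter.atTop (nhds 0) := by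
    have h := (Real.tendsto_exp_atBot.comp (Filter.tendsto_id.const_mul_atTop_of_neg
      (show -(c / 2) < 0 by linarith))).mul_const
      (expNorm ⟨c / 2, half_pos hc⟩ f * Real.exp (c / 2 * ‖z‖))
    rwa [zero_mul] at h
  refine squeeze_zero_norm' ?_ hlim
  filter_upwards [Filter.eventually_ge_atTop 0] with x hx
  exact norm_exp_mul_shift_le f z hc hx

theorem gammaLaw_formula {α : ℝ} (hα : 0 < α) (g : EMin) (z : ℂ) :
    Integrable (fun x : ℝ => (1 - (α : ℂ) • hDeriv 0) g (z + x)) (gammaLaw α (α ^ 2)) ∧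
      g z = ∫ x : ℝ, (1 - (α : ℂ) • hDeriv 0) g (z + x) ∂(gammaLaw α (α ^ 2)) := by
  have hm : Measurable fun x : ℝ => α⁻¹ * Real.exp (-α⁻¹ * x) := by fun_prop
  have hp : ∀ x : ℝ, 0 ≤ α⁻¹ * Real.exp (-α⁻¹ * x) := fun x => by positivity
  have hα' : (α : ℂ) ≠ 0 := Complex.ofReal_ne_zero.mpr hα.ne'
  have hint : IntegrableOn (fun x : ℝ => ((α⁻¹ * Real.exp (-α⁻¹ * x) : ℝ) : ℂ) *
      (1 - (α : ℂ) • hDeriv 0) g (z + x)) (Set.Ioi 0) := by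
    simpa only [IntegrableOn, Complex.ofReal_mul, mul_assoc] using
      (integrableOn_exp_mul_shift ((1 - (α : ℂ) • hDeriv 0) g) z (inv_pos.mpr hα)).const_mul
        ((α⁻¹ : ℝ) : ℂ)
  rw [gammaLaw_sq hα, integrable_withDensity_ofReal_iff hm hp, integral_withDensity_ofReal hm hp]
  refine ⟨hint, ?_⟩
  -- The integrand has the primitive `-exp(-x/α) g(z+x)`, which equals `-g(z)` at 0 and tends to 0
  -- at infinity.
  have hder : ∀ x ∈ Set.Ici (0 : ℝ), HasDerivAt
      (fun x : ℝ => -((Real.exp (-α⁻¹ * x) : ℂ) * g (z + x)))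
      (((α⁻¹ * Real.exp (-α⁻¹ * x) : ℝ) : ℂ) * (1 - (α : ℂ) • hDeriv 0) g (z + x)) x := by
    intro x _
    have h1 : HasDerivAt (fun x : ℝ => (Real.exp (-α⁻¹ * x) : ℂ))
        ((Real.exp (-α⁻¹ * x) * (-α⁻¹) : ℝ) : ℂ) x := by
      simpa using (((hasDerivAt_id x).const_mul (-α⁻¹)).exp).ofReal_comp
    have h2 : HasDerivAt (fun x : ℝ => g (z + x)) (deriv g (z + x)) x :=
      ((g.differentiable (z + x)).hasDerivAt.comp_const_add z (x : ℂ)).comp_ofReal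
    refine (h1.mul h2).neg.congr_deriv ?_
    have : (1 - (α : ℂ) • hDeriv 0) g (z + x) = g (z + x) - α * deriv g (z + x) := by
      rw [← hDeriv_zero_apply]; rfl
    rw [this]
    push_cast
    field_simp
    ring
  have hlim := (tendsto_exp_mul_shift g z (inv_pos.mpr hα)).neg
  rw [neg_zero] at hlim
  rw [integral_Ioi_of_hasDerivAt_of_tendsto' hder hint hlim]
  simp

/-! ### The geometric distribution -/

theorem negBinomialLaw_mul {α β : ℝ} (hβ : 0 < β) (hβα : β < α) :
    negBinomialLaw α β (α * β) = Measure.sum fun n : ℕ =>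
      ENNReal.ofReal ((1 - β / α) * (β / α) ^ n) • Measure.dirac ((α - β) * n) := by
  have hα : 0 < α := hβ.trans hβα
  have h : α * β / (α * β) = 1 := div_self (by positivity)
  unfold negBinomialLaw
  congr 1
  funext n
  have hn : (n.factorial : ℝ) ≠ 0 := by positivity
  rw [h, Real.rpow_one, ascPochhammer_eval_one, mul_assoc ((β / α) ^ n), one_div,
    inv_mul_cancel₀ hn, mul_one]

theorem summable_pow_mul_norm_shift (f : EMin) (z : ℂ) {q δ : ℝ} (hq : 0 < q) (hq1 : q < 1)
    (hδ : 0 < δ) : Summable fun n : ℕ => q ^ n * ‖f (z + ((δ * n : ℝ) : ℂ))‖ := by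
  have hL : 0 < -Real.log q := neg_pos.mpr (Real.log_neg hq hq1)
  -- With this index, `f(z + δ n)` grows at most like `q^(-n/2)`, so the terms decay like `q^(n/2)`.
  have hs : 0 < -Real.log q / 2 / δ := by positivity
  have hr : Real.exp (-(-Real.log q / 2)) < 1 := by
    rw [Real.exp_lt_one_iff]; linarith
  refine Summable.of_nonneg_of_le (fun n => by positivity) (fun n => ?_)
    ((summable_geometric_of_lt_one (Real.exp_pos _).le hr).mul_right
      (expNorm ⟨_, hs⟩ f * Real.exp (-Real.log q / 2 / δ * ‖z‖)))
  have h1 := norm_shift_le f ((δ * n : ℝ) : ℂ) ⟨_, hs⟩ z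
  rw [Complex.norm_real, Real.norm_of_nonneg (by positivity)] at h1
  refine (mul_le_mul_of_nonneg_left h1 (by positivity)).trans (le_of_eq ?_)
  have h2 : q ^ n * Real.exp (-Real.log q / 2 / δ * (δ * n))
      = Real.exp (-(-Real.log q / 2)) ^ n := by
    rw [← Real.exp_nat_mul]
    nth_rewrite 1 [← Real.exp_log hq]
    rw [← Real.exp_nat_mul, ← Real.exp_add]
    congr 1
    field_simp
    ring
  rw [← h2]
  ring

theorem negBinomialLaw_formula {α β : ℝ} (hβ : 0 < β) (hβα : β < α) (g : EMin) (z : ℂ) :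
    Integrable (fun x : ℝ => (1 - (α : ℂ) • hDeriv (β - α)) g (z + x) * (α / β)
        - (1 - (α : ℂ) • hDeriv (β - α)) g z * ((α - β) / β)) (negBinomialLaw α β (α * β)) ∧
      g z = ∫ x : ℝ, ((1 - (α : ℂ) • hDeriv (β - α)) g (z + x) * (α / β)
        - (1 - (α : ℂ) • hDeriv (β - α)) g z * ((α - β) / β)) ∂(negBinomialLaw α β (α * β)) := by
  have hα : 0 < α := hβ.trans hβα
  have hα' : (α : ℂ) ≠ 0 := Complex.ofReal_ne_zero.mpr hα.ne'
  have hβ' : (β : ℂ) ≠ 0 := Complex.ofReal_ne_zero.mpr hβ.ne'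
  have hδ : 0 < α - β := sub_pos.mpr hβα
  have hδ' : (α : ℂ) - β ≠ 0 := by exact_mod_cast hδ.ne'
  have hδ'' : (β : ℂ) - α ≠ 0 := by rw [← neg_sub]; exact neg_ne_zero.mpr hδ'
  have hq : 0 < β / α := by positivity
  have hq1 : β / α < 1 := (div_lt_one hα).mpr hβα
  have hq1' : 0 ≤ 1 - β / α := by linarith
  set f := (1 - (α : ℂ) • hDeriv (β - α)) g with hf
  have hfg : ∀ w, f w = (α * g (w - (α - β)) - β * g w) / (α - β) := by
    intro w
    have : f w = g w - α * hDeriv (β - α) g w := rfl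
    rw [this, hDeriv_apply hδ'', ← neg_sub (α : ℂ) β, ← sub_eq_add_neg]
    field_simp
    ring
  have hc : ∀ n : ℕ, (ENNReal.ofReal ((1 - β / α) * (β / α) ^ n)).toReal
      = (1 - β / α) * (β / α) ^ n := fun n => ENNReal.toReal_ofReal (by positivity)
  have hgeo := (hasSum_geometric_of_lt_one hq.le hq1).mul_left (1 - β / α)
  rw [mul_inv_cancel₀ (by linarith)] at hgeo
  have hsum : Summable fun n : ℕ => (ENNReal.ofReal ((1 - β / α) * (β / α) ^ n)).toReal *
      ‖f (z + (((α - β) * n : ℝ) : ℂ)) * (α / β) - f z * ((α - β) / β)‖ := by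
    refine Summable.of_nonneg_of_le (fun n => by positivity) (fun n => ?_)
      ((((summable_pow_mul_norm_shift f z hq hq1 hδ).mul_left (1 - β / α)).mul_right
        ‖(α / β : ℂ)‖).add (hgeo.summable.mul_right ‖f z * ((α - β) / β)‖))
    rw [hc]
    have h1 := norm_sub_le (f (z + (((α - β) * n : ℝ) : ℂ)) * (α / β)) (f z * ((α - β) / β))
    rw [norm_mul (f (z + (((α - β) * n : ℝ) : ℂ)))] at h1
    refine (mul_le_mul_of_nonneg_left h1 (by positivity)).trans (le_of_eq ?_)
    ring
  rw [negBinomialLaw_mul hβ hβα]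
  refine ⟨integrable_sum_dirac (by simp) hsum, ?_⟩
  refine HasSum.unique ?_ (hasSum_integral_sum_dirac (by simp) hsum)
  have hB : Summable fun n : ℕ => ((β / α : ℝ) ^ n : ℂ) *
      g (z - (α - β) + (((α - β) * n : ℝ) : ℂ)) * (α / β) := by
    refine Summable.mul_right _ (Summable.of_norm ?_)
    convert summable_pow_mul_norm_shift g (z - (α - β)) hq hq1 hδ using 2 with n
    rw [norm_mul, norm_pow, Complex.norm_real, Real.norm_of_nonneg hq.le]
  -- With `a_n = qⁿ g(z - (α-β) + (α-β) n) α/β` and `q = β/α`, the weighted value of `f` at the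
  -- `n`-th atom, times `α/β`, is `a_n - a_{n+1}`. The series telescopes to `a_0 = g(z - (α-β))
  -- α/β`, and subtracting `f(z)(α-β)/β` leaves `g(z)`.
  have hB1 := (hasSum_nat_add_iff' 1).mpr hB.hasSum
  have htel := (hB.hasSum.sub hB1).sub
    ((Complex.hasSum_ofReal.mpr hgeo).mul_right (f z * ((α - β) / β)))
  convert htel using 1
  · funext n
    rw [hc, Complex.real_smul, hfg (z + _)]
    have e1 : z + (((α - β) * n : ℝ) : ℂ) - (α - β)
        = z - (α - β) + (((α - β) * n : ℝ) : ℂ) := by ring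
    have e2 : z - (α - β) + (((α - β) * (n + 1 : ℕ) : ℝ) : ℂ)
        = z + (((α - β) * n : ℝ) : ℂ) := by push_cast; ring
    rw [e1, e2]
    push_cast
    rw [pow_succ]
    field_simp
  · rw [hfg z]
    simp
    field_simp
    ring

/-! ### The hyperbolic secant and a contour integral -/

theorem integrable_exp_neg_mul_abs {c : ℝ} (hc : 0 < c) :
    Integrable fun x : ℝ => Real.exp (-(c * |x|)) := by
  rw [← integrableOn_univ, ← Set.Iic_union_Ioi (a := (0 : ℝ)), integrableOn_union]
  exact ⟨(integrableOn_exp_mul_Iic hc 0).congr_fun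
      (fun x hx => by simp only [abs_of_nonpos (Set.mem_Iic.mp hx), mul_neg, neg_neg])
      measurableSet_Iic,
    (exp_neg_integrableOn_Ioi 0 hc).congr_fun
      (fun x hx => by simp only [abs_of_pos (Set.mem_Ioi.mp hx), neg_mul]) measurableSet_Ioi⟩

theorem inv_cosh_le (x : ℝ) : (Real.cosh x)⁻¹ ≤ 2 * Real.exp (-|x|) := by
  rw [← Real.cosh_abs, inv_le_iff_one_le_mul₀ (Real.cosh_pos _), Real.cosh_eq]
  have h1 := Real.exp_pos (-|x|)
  have h2 : Real.exp (-|x|) * Real.exp |x| = 1 := by rw [← Real.exp_add]; simp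
  nlinarith

theorem integrable_inv_cosh : Integrable fun x : ℝ => (Real.cosh (Real.pi / 2 * x))⁻¹ := by
  refine ((integrable_exp_neg_mul_abs (c := Real.pi / 2) (by positivity)).const_mul 2).mono'
    (Continuous.aestronglyMeasurable ?_) (ae_of_all _ fun x => ?_)
  · exact Continuous.inv₀ (by fun_prop) fun x => (Real.cosh_pos _).ne'
  · rw [Real.norm_of_nonneg (by positivity)]
    refine (inv_cosh_le _).trans (le_of_eq ?_)
    rw [abs_mul, abs_of_pos (show 0 < Real.pi / 2 by positivity)]

theorem integral_inv_cosh : ∫ x : ℝ, (Real.cosh (Real.pi / 2 * x))⁻¹ = 2 := by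
  have hpi := Real.pi_pos
  have hder : ∀ x : ℝ, HasDerivAt
      (fun x => 4 / Real.pi * Real.arctan (Real.exp (Real.pi / 2 * x)))
      (Real.cosh (Real.pi / 2 * x))⁻¹ x := by
    intro x
    refine ((((hasDerivAt_id x).const_mul (Real.pi / 2)).exp.arctan).const_mul
      (4 / Real.pi)).congr_deriv ?_
    have h := Real.exp_pos (Real.pi / 2 * x)
    simp only [id, mul_one]
    rw [Real.cosh_eq, Real.exp_neg]
    field_simp
    ring
  have h1 : Filter.Tendsto (fun x : ℝ => Real.pi / 2 * x) Filter.atBot Filter.atBot :=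
    Filter.tendsto_id.const_mul_atBot (by positivity)
  have h2 : Filter.Tendsto (fun x : ℝ => Real.pi / 2 * x) Filter.atTop Filter.atTop :=
    Filter.tendsto_id.const_mul_atTop (by positivity)
  have hbot : Filter.Tendsto (fun x => 4 / Real.pi * Real.arctan (Real.exp (Real.pi / 2 * x)))
      Filter.atBot (nhds (4 / Real.pi * Real.arctan 0)) :=
    ((Real.continuous_arctan.tendsto 0).comp (Real.tendsto_exp_atBot.comp h1)).const_mul _
  have htop : Filter.Tendsto (fun x => 4 / Real.pi * Real.arctan (Real.exp (Real.pi / 2 * x)))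
      Filter.atTop (nhds (4 / Real.pi * (Real.pi / 2))) :=
    ((Real.tendsto_arctan_atTop.mono_right nhdsWithin_le_nhds).comp
      (Real.tendsto_exp_atTop.comp h2)).const_mul _
  rw [integral_of_hasDerivAt_of_tendsto hder integrable_inv_cosh hbot htop]
  rw [Real.arctan_zero]
  field_simp
  ring

/-- A holomorphic function in the strip `|Im z| < 2` with the values
`(H z - H 0) / sinh (π z / 2)` for `z ≠ 0`. -/
theorem exists_div_sinh {H : ℂ → ℂ} (hH : Differentiable ℂ H) : ∃ Q : ℂ → ℂ,
    (∀ z : ℂ, |z.im| < 2 → DifferentiableAt ℂ Q z) ∧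
    ∀ z : ℂ, z ≠ 0 → Q z = (H z - H 0) / Complex.sinh (Real.pi / 2 * z) := by
  set S : ℂ → ℂ := fun z => Complex.sinh (Real.pi / 2 * z) with hS
  have hSd : Differentiable ℂ S := by fun_prop
  have hpi : (Real.pi : ℂ) ≠ 0 := Complex.ofReal_ne_zero.mpr Real.pi_ne_zero
  have hS0 : S 0 = 0 := by simp [hS]
  have hds : ∀ {F : ℂ → ℂ}, Differentiable ℂ F → Differentiable ℂ (dslope F 0) := fun hF =>
    differentiableOn_univ.mp
      ((Complex.differentiableOn_dslope Filter.univ_mem).mpr hF.differentiableOn)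
  -- Dividing numerator and denominator by `z` removes the singularity at 0; `dslope` supplies the
  -- holomorphic value there.
  refine ⟨fun z => dslope H 0 z / dslope S 0 z, fun z hz => ?_, fun z hz => ?_⟩
  · refine (hds hH z).div (hds hSd z) ?_
    by_cases hz0 : z = 0
    · subst hz0
      have : HasDerivAt S (Complex.cosh (Real.pi / 2 * 0) * (Real.pi / 2 * 1)) 0 :=
        ((hasDerivAt_id (0 : ℂ)).const_mul (Real.pi / 2 : ℂ)).csinh
      rw [dslope_same, this.deriv]
      simp [hpi]
    · rw [dslope_of_ne _ hz0, slope_def_field, hS0, sub_zero, sub_zero]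
      -- The zeros of `sinh(πz/2)` are the points `2ik` with `k` an integer, so 0 is the only one
      -- with `|Im z| < 2`.
      refine div_ne_zero (fun h => ?_) hz0
      have h1 : Complex.sin (Real.pi / 2 * z * Complex.I) = 0 := by
        rw [Complex.sin_mul_I]
        simp [hS] at h
        simp [h]
      obtain ⟨k, hk⟩ := Complex.sin_eq_zero_iff.mp h1
      have h2 : z * Complex.I = 2 * k := by
        have : (Real.pi : ℂ) * (z * Complex.I) = Real.pi * (2 * k) := by linear_combination 2 * hk
        exact mul_left_cancel₀ hpi this
      have hre : -z.im = 2 * k := by simpa using congrArg Complex.re h2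
      have him : z.re = 0 := by simpa using congrArg Complex.im h2
      have hk' : |(k : ℝ)| < 1 := by
        have : |z.im| = 2 * |(k : ℝ)| := by rw [← abs_neg, hre, abs_mul]; simp
        linarith
      have hk0 : k = 0 := by
        rw [← Int.abs_lt_one_iff]
        exact_mod_cast hk'
      refine hz0 (Complex.ext him ?_)
      rw [hk0] at hre
      simpa using hre
  · simp only
    rw [dslope_of_ne _ hz, dslope_of_ne _ hz, slope_def_field, slope_def_field, hS0, sub_zero,
      sub_zero]
    exact div_div_div_cancel_right₀ hz _ _

theorem sinh_sub_I (x : ℝ) : Complex.sinh (Real.pi / 2 * (x - Complex.I))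
    = -Complex.I * (Real.cosh (Real.pi / 2 * x) : ℝ) := by
  rw [mul_sub, Complex.sinh_sub, Complex.sinh_mul_I, Complex.cosh_mul_I]
  simp [mul_comm]

theorem sinh_add_I (x : ℝ) : Complex.sinh (Real.pi / 2 * (x + Complex.I))
    = Complex.I * (Real.cosh (Real.pi / 2 * x) : ℝ) := by
  rw [mul_add, Complex.sinh_add, Complex.sinh_mul_I, Complex.cosh_mul_I]
  simp [mul_comm]

theorem le_norm_sinh (z : ℂ) : Real.sinh |z.re| ≤ ‖Complex.sinh z‖ := by
  have h1 : ‖Complex.exp z‖ = Real.exp z.re := Complex.norm_exp z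
  have h2 : ‖Complex.exp (-z)‖ = Real.exp (-z.re) := by rw [Complex.norm_exp]; simp
  have h3 := abs_norm_sub_norm_le (Complex.exp z) (Complex.exp (-z))
  rw [h1, h2] at h3
  rw [Complex.sinh, norm_div, ← Real.abs_sinh, Real.sinh_eq, abs_div]
  simp only [Complex.norm_ofNat, Nat.abs_ofNat]
  gcongr

/-! ### Cauchy's theorem in the strip `|Im z| ≤ 1` -/

section Contour

variable {H : ℂ → ℂ} {K c : ℝ}

theorem norm_sub_zero_le (hc : 0 ≤ c) (hK : ∀ z, ‖H z‖ ≤ K * Real.exp (c * ‖z‖))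
    {z : ℂ} {x : ℝ} (hz : ‖z‖ ≤ |x| + 1) :
    ‖H z - H 0‖ ≤ 2 * K * Real.exp c * Real.exp (c * |x|) := by
  have hK0 : 0 ≤ K := by simpa using (norm_nonneg _).trans (hK 0)
  have h1 : ∀ w : ℂ, ‖w‖ ≤ |x| + 1 → ‖H w‖ ≤ K * (Real.exp c * Real.exp (c * |x|)) := by
    intro w hw
    refine (hK w).trans ?_
    rw [← Real.exp_add]
    gcongr
    nlinarith
  have h2 := norm_sub_le (H z) (H 0)
  have h3 := h1 z hz
  have h4 := h1 0 (by simp; positivity)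
  linarith

theorem integrable_mul_inv_cosh (hc' : c < Real.pi / 2) {F : ℝ → ℂ}
    (hF : Continuous F) {L : ℝ} (hL : ∀ x, ‖F x‖ ≤ L * Real.exp (c * |x|)) :
    Integrable fun x : ℝ => F x * (((Real.cosh (Real.pi / 2 * x))⁻¹ : ℝ) : ℂ) := by
  refine ((integrable_exp_neg_mul_abs (sub_pos.mpr hc')).const_mul (2 * L)).mono'
    (Continuous.aestronglyMeasurable ?_) (ae_of_all _ fun x => ?_)
  · refine hF.mul (Complex.continuous_ofReal.comp (Continuous.inv₀ (by fun_prop) fun x =>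
      (Real.cosh_pos _).ne'))
  · rw [norm_mul, Complex.norm_real, Real.norm_of_nonneg (by positivity)]
    have h1 := inv_cosh_le (Real.pi / 2 * x)
    rw [abs_mul, abs_of_pos (show 0 < Real.pi / 2 by positivity)] at h1
    calc ‖F x‖ * (Real.cosh (Real.pi / 2 * x))⁻¹
        ≤ (L * Real.exp (c * |x|)) * (2 * Real.exp (-(Real.pi / 2 * |x|))) :=
          mul_le_mul (hL x) h1 (by positivity) ((norm_nonneg _).trans (hL x))
      _ = 2 * L * (Real.exp (c * |x|) * Real.exp (-(Real.pi / 2 * |x|))) := by ring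
      _ = _ := by rw [← Real.exp_add]; ring_nf

theorem norm_ofReal_add_mul_I_le {x y : ℝ} (hy : |y| ≤ 1) : ‖(x : ℂ) + y * Complex.I‖ ≤ |x| + 1 := by
  refine (norm_add_le _ _).trans ?_
  simpa using hy

/-- Integrate `(H - H(0)) / sinh(πz/2)` around `[-R, R] × [-1, 1]`. On the horizontal sides `sinh`
becomes `±i cosh`, and the vertical sides vanish as `R → ∞` because `c < π/2`. So the integral of
`(H(x-i) + H(x+i) - 2H(0)) / cosh(πx/2)` is zero, and `∫ 1/cosh(πx/2) = 2`. Subtracting `H(0)`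
replaces a residue computation. -/
theorem integral_horizontal_eq (hH : Differentiable ℂ H) (hc : 0 ≤ c) (hc' : c < Real.pi / 2)
    (hK : ∀ z, ‖H z‖ ≤ K * Real.exp (c * ‖z‖)) :
    Integrable (fun x : ℝ => (H (x - Complex.I) + H (x + Complex.I)) *
      (((Real.cosh (Real.pi / 2 * x))⁻¹ : ℝ) : ℂ)) ∧
    ∫ x : ℝ, (H (x - Complex.I) + H (x + Complex.I)) *
      (((Real.cosh (Real.pi / 2 * x))⁻¹ : ℝ) : ℂ) = 4 * H 0 := by
  have hHc := hH.continuous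
  have hK0 : 0 ≤ K := by simpa using (norm_nonneg _).trans (hK 0)
  have hpi := Real.pi_pos
  have hnm : ∀ x : ℝ, ‖(x : ℂ) - Complex.I‖ ≤ |x| + 1 := fun x => by
    simpa [sub_eq_add_neg] using norm_ofReal_add_mul_I_le (x := x) (y := -1) (by simp)
  have hnp : ∀ x : ℝ, ‖(x : ℂ) + Complex.I‖ ≤ |x| + 1 := fun x => by
    simpa using norm_ofReal_add_mul_I_le (x := x) (y := 1) (by simp)
  obtain ⟨Q, hQd, hQ⟩ := exists_div_sinh hH
  have hne : ∀ {z : ℂ}, z.im ≠ 0 → z ≠ 0 := fun h h0 => h (by simp [h0])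
  have hQm : ∀ x : ℝ, Q (x - Complex.I) = Complex.I *
      ((H (x - Complex.I) - H 0) * (((Real.cosh (Real.pi / 2 * x))⁻¹ : ℝ) : ℂ)) := by
    intro x
    rw [hQ _ (hne (by simp)), sinh_sub_I, Complex.ofReal_inv, div_eq_mul_inv, mul_inv, inv_neg,
      Complex.inv_I]
    ring
  have hQp : ∀ x : ℝ, Q (x + Complex.I) = -Complex.I *
      ((H (x + Complex.I) - H 0) * (((Real.cosh (Real.pi / 2 * x))⁻¹ : ℝ) : ℂ)) := by
    intro x
    rw [hQ _ (hne (by simp)), sinh_add_I, Complex.ofReal_inv, div_eq_mul_inv, mul_inv,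
      Complex.inv_I]
    ring
  have him := integrable_mul_inv_cosh hc' (F := fun x : ℝ => H (x - Complex.I) - H 0)
    (by fun_prop) fun x => norm_sub_zero_le hc hK (hnm x)
  have hip := integrable_mul_inv_cosh hc' (F := fun x : ℝ => H (x + Complex.I) - H 0)
    (by fun_prop) fun x => norm_sub_zero_le hc hK (hnp x)
  have hQmi : Integrable fun x : ℝ => Q (x - Complex.I) := by
    simp only [hQm]; exact him.const_mul _
  have hQpi : Integrable fun x : ℝ => Q (x + Complex.I) := by
    simp only [hQp]; exact hip.const_mul _
  have hside : ∀ R : ℝ, 1 ≤ |R| → ‖∫ y in (-1 : ℝ)..1, Q (R + y * Complex.I)‖ ≤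
      2 * K * Real.exp c * 8 * Real.exp (-((Real.pi / 2 - c) * |R|)) := by
    intro R hR
    have hbd : ∀ y ∈ Set.uIoc (-1 : ℝ) 1, ‖Q (R + y * Complex.I)‖ ≤
        2 * K * Real.exp c * 4 * Real.exp (-((Real.pi / 2 - c) * |R|)) := by
      intro y hy
      rw [Set.uIoc_of_le (by norm_num)] at hy
      have hz0 : (R : ℂ) + y * Complex.I ≠ 0 := fun h => by
        have : R = 0 := by simpa using congrArg Complex.re h
        rw [this] at hR
        norm_num at hR
      rw [hQ _ hz0, norm_div]
      have h1 := norm_sub_zero_le hc hK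
        (norm_ofReal_add_mul_I_le (x := R) (abs_le.mpr ⟨hy.1.le, hy.2⟩))
      have h2 := le_norm_sinh (Real.pi / 2 * (R + y * Complex.I))
      have hre : (Real.pi / 2 * (R + y * Complex.I) : ℂ).re = Real.pi / 2 * R := by
        rw [← Complex.ofReal_ofNat, ← Complex.ofReal_div, Complex.re_ofReal_mul]
        simp
      rw [hre, abs_mul, abs_of_pos (show 0 < Real.pi / 2 by positivity)] at h2
      -- For `u ≥ 1` one has `exp u ≥ 2` and `exp(-u) ≤ 1`, which gives `sinh u ≥ exp(u)/4`.
      have h3 : Real.exp (Real.pi / 2 * |R|) / 4 ≤ Real.sinh (Real.pi / 2 * |R|) := by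
        have hge : 1 ≤ Real.pi / 2 * |R| := by nlinarith [Real.pi_gt_three]
        have h4 : Real.exp (-(Real.pi / 2 * |R|)) ≤ 1 := Real.exp_le_one_iff.mpr (by linarith)
        have h5 := Real.add_one_le_exp (Real.pi / 2 * |R|)
        rw [Real.sinh_eq]
        linarith
      have h6 := h3.trans h2
      rw [div_le_iff₀ (lt_of_lt_of_le (by positivity) h6)]
      refine h1.trans ?_
      calc 2 * K * Real.exp c * Real.exp (c * |R|)
          = 2 * K * Real.exp c * 4 * Real.exp (-((Real.pi / 2 - c) * |R|)) *
            (Real.exp (Real.pi / 2 * |R|) / 4) := by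
            have : Real.exp (c * |R|) = Real.exp (-((Real.pi / 2 - c) * |R|)) *
                Real.exp (Real.pi / 2 * |R|) := by rw [← Real.exp_add]; ring_nf
            rw [this]; ring
        _ ≤ _ := by gcongr
    refine (intervalIntegral.norm_integral_le_of_norm_le_const hbd).trans (le_of_eq ?_)
    norm_num
    ring
  have hsidelim : ∀ ε : ℝ, |ε| = 1 → Filter.Tendsto
      (fun R : ℝ => ∫ y in (-1 : ℝ)..1, Q ((ε * R : ℝ) + y * Complex.I)) Filter.atTop
      (nhds 0) := by
    intro ε hε
    have hlim : Filter.Tendsto (fun R : ℝ => 2 * K * Real.exp c * 8 *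
        Real.exp (-((Real.pi / 2 - c) * R))) Filter.atTop (nhds 0) := by
      rw [← mul_zero (2 * K * Real.exp c * 8)]
      refine Filter.Tendsto.const_mul _ (Real.tendsto_exp_neg_atTop_nhds_zero.comp ?_)
      exact Filter.tendsto_id.const_mul_atTop (sub_pos.mpr hc')
    refine squeeze_zero_norm' ?_ hlim
    filter_upwards [Filter.eventually_ge_atTop 1] with R hR
    have hR' : |ε * R| = R := by rw [abs_mul, hε, one_mul, abs_of_pos (by linarith)]
    have := hside (ε * R) (by rw [hR']; exact hR)
    rwa [hR'] at this
  have hrect : ∀ R : ℝ, (∫ x in (-R)..R, Q (x - Complex.I)) - (∫ x in (-R)..R, Q (x + Complex.I))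
      + Complex.I * (∫ y in (-1 : ℝ)..1, Q ((1 * R : ℝ) + y * Complex.I))
      - Complex.I * (∫ y in (-1 : ℝ)..1, Q ((-1 * R : ℝ) + y * Complex.I)) = 0 := by
    intro R
    have := Complex.integral_boundary_rect_eq_zero_of_differentiableOn Q ⟨-R, -1⟩ ⟨R, 1⟩ ?_
    · simpa [sub_eq_add_neg] using this
    · intro z hz
      have hz2 : z.im ∈ Set.uIcc (-1 : ℝ) 1 := hz.2
      rw [Set.uIcc_of_le (by norm_num)] at hz2
      exact (hQd z (lt_of_le_of_lt (abs_le.mpr hz2) (by norm_num))).differentiableWithinAt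
  have hlim := (((intervalIntegral_tendsto_integral hQmi Filter.tendsto_neg_atTop_atBot
    Filter.tendsto_id).sub (intervalIntegral_tendsto_integral hQpi Filter.tendsto_neg_atTop_atBot
    Filter.tendsto_id)).add ((hsidelim 1 (by simp)).const_mul Complex.I)).sub
    ((hsidelim (-1) (by simp)).const_mul Complex.I)
  have heq := tendsto_nhds_unique (hlim.congr hrect) tendsto_const_nhds
  simp only [hQm, hQp, mul_zero, add_zero, sub_zero] at heq
  rw [integral_const_mul, integral_const_mul, neg_mul, sub_neg_eq_add, ← mul_add] at heq
  have heq' := (mul_eq_zero.mp heq).resolve_left Complex.I_ne_zero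
  rw [← integral_add him hip] at heq'
  have hi0 : Integrable fun x : ℝ => 2 * H 0 * (((Real.cosh (Real.pi / 2 * x))⁻¹ : ℝ) : ℂ) :=
    integrable_inv_cosh.ofReal.const_mul _
  have hfun : (fun x : ℝ => (H (x - Complex.I) + H (x + Complex.I)) *
      (((Real.cosh (Real.pi / 2 * x))⁻¹ : ℝ) : ℂ)) = fun x : ℝ =>
      ((H (x - Complex.I) - H 0) * (((Real.cosh (Real.pi / 2 * x))⁻¹ : ℝ) : ℂ)
      + (H (x + Complex.I) - H 0) * (((Real.cosh (Real.pi / 2 * x))⁻¹ : ℝ) : ℂ))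
      + 2 * H 0 * (((Real.cosh (Real.pi / 2 * x))⁻¹ : ℝ) : ℂ) := by
    funext x
    ring
  rw [hfun]
  refine ⟨(him.add hip).add hi0, ?_⟩
  rw [integral_add (by exact him.add hip) hi0, heq', integral_const_mul, integral_complex_ofReal,
    integral_inv_cosh]
  push_cast
  ring

end Contour

/-! ### The Meixner distribution -/

/-- On the line `Re s = 1/2` one has `1 - s = conj s`, so the reflection formula for `Γ(s) Γ(1-s)`
computes `|Γ(s)|²`. -/
theorem norm_Gamma_half_add_sq (y : ℝ) :
    ‖Complex.Gamma (1 / 2 + y * Complex.I)‖ ^ 2 = Real.pi * (Real.cosh (Real.pi * y))⁻¹ := by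
  have h1 := Complex.Gamma_mul_Gamma_one_sub (1 / 2 + y * Complex.I)
  have h2 : 1 - (1 / 2 + y * Complex.I) = (starRingEnd ℂ) (1 / 2 + y * Complex.I) := by
    simp only [map_add, map_mul, map_div₀, map_one, map_ofNat, Complex.conj_ofReal, Complex.conj_I]
    ring
  have h3 : Complex.sin (Real.pi * (1 / 2 + y * Complex.I)) = (Real.cosh (Real.pi * y) : ℂ) := by
    have : (Real.pi : ℂ) * (1 / 2 + y * Complex.I)
        = (Real.pi * y : ℝ) * Complex.I + Real.pi / 2 := by
      push_cast; ring
    rw [this, Complex.sin_add_pi_div_two, Complex.cos_mul_I, Complex.ofReal_cosh]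
  rw [h2, Complex.Gamma_conj, Complex.mul_conj', h3, div_eq_mul_inv] at h1
  exact_mod_cast h1

section Meixner

variable {α : ℂ}

theorem arg_pos_of_im_pos (hi : 0 < α.im) : 0 < α.arg := by
  refine lt_of_le_of_ne (Complex.arg_nonneg_iff.mpr hi.le) fun h => ?_
  have := (Complex.arg_eq_zero_iff.mp h.symm).2
  exact hi.ne' this

/-- The density of the Meixner distribution `μ_{α,β,αβ}`. -/
noncomputable def meixnerDensity (α : ℂ) (x : ℝ) : ℝ :=
  (2 * ‖α‖)⁻¹ * Real.exp ((Real.pi / 2 - α.arg) * ((x + α.re) / α.im)) *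
    (Real.cosh (Real.pi / 2 * ((x + α.re) / α.im)))⁻¹

theorem meixnerDensity_nonneg (α : ℂ) (x : ℝ) : 0 ≤ meixnerDensity α x := by
  unfold meixnerDensity; positivity

theorem measurable_meixnerDensity (α : ℂ) : Measurable (meixnerDensity α) := by
  unfold meixnerDensity; fun_prop

/-- For `τ = η` the summand `iβ/(2 Im α)` has real part 1/2, so the Gamma factor is evaluated on the
critical line and becomes a hyperbolic secant. -/
theorem meixnerLaw_norm_sq (hi : 0 < α.im) : meixnerLaw α (‖α‖ ^ 2) =
    volume.withDensity fun x => ENNReal.ofReal (meixnerDensity α x) := by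
  have hα : α ≠ 0 := fun h => by simp [h] at hi
  have hr : 0 < ‖α‖ := norm_pos_iff.mpr hα
  have hpi := Real.pi_pos
  unfold meixnerLaw
  congr 1
  funext x
  congr 1
  have hdiv : ‖α‖ ^ 2 / ‖α‖ ^ 2 = 1 := div_self (by positivity)
  have hi' : (α.im : ℂ) ≠ 0 := Complex.ofReal_ne_zero.mpr hi.ne'
  have hr' : (‖α‖ : ℂ) ≠ 0 := Complex.ofReal_ne_zero.mpr hr.ne'
  have harg : Complex.I * x / (2 * α.im)
        + Complex.I * (‖α‖ ^ 2 : ℝ) * (starRingEnd ℂ) α / (2 * (‖α‖ ^ 2 : ℝ) * α.im)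
      = 1 / 2 + (((x + α.re) / α.im / 2 : ℝ) : ℂ) * Complex.I := by
    have hconj : (starRingEnd ℂ) α = α.re - α.im * Complex.I := by
      apply Complex.ext <;> simp
    rw [hconj]
    push_cast
    field_simp
    linear_combination -α.im * Complex.I_sq
  rw [harg, norm_Gamma_half_add_sq, meixnerConst, hdiv, Real.rpow_one, Real.Gamma_one,
    Real.cos_pi_div_two_sub, Complex.sin_arg, meixnerDensity]
  have e1 : Real.exp ((Real.pi / 2 - α.arg) * ((x + α.re) / α.im)) =
      Real.exp ((Real.pi / 2 - α.arg) * ‖α‖ ^ 2 * α.re / (α.im * ‖α‖ ^ 2)) *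
        Real.exp ((Real.pi / 2 - α.arg) * x / α.im) := by
    rw [← Real.exp_add]
    congr 1
    field_simp
    ring
  have e2 : Real.pi * ((x + α.re) / α.im / 2) = Real.pi / 2 * ((x + α.re) / α.im) := by ring
  rw [e1, e2]
  field_simp
  norm_num

theorem exp_pi_div_two_sub_arg_mul_I (hα : α ≠ 0) :
    Complex.exp ((Real.pi / 2 - α.arg : ℝ) * Complex.I) = (α.im + α.re * Complex.I) / ‖α‖ := by
  rw [Complex.exp_mul_I, ← Complex.ofReal_cos, ← Complex.ofReal_sin, Real.cos_pi_div_two_sub,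
    Real.sin_pi_div_two_sub, Complex.sin_arg, Complex.cos_arg hα]
  push_cast
  ring

theorem exp_neg_pi_div_two_sub_arg_mul_I (hα : α ≠ 0) :
    Complex.exp (-((Real.pi / 2 - α.arg : ℝ) * Complex.I)) = (α.im - α.re * Complex.I) / ‖α‖ := by
  rw [← neg_mul, Complex.exp_mul_I, Complex.cos_neg, Complex.sin_neg, ← Complex.ofReal_cos,
    ← Complex.ofReal_sin, Real.cos_pi_div_two_sub,
    Real.sin_pi_div_two_sub, Complex.sin_arg, Complex.cos_arg hα]
  push_cast
  ring

theorem norm_shift_mul_exp_le (g : EMin) (w : ℂ) {a k : ℝ} (ha : 0 < a) (hk : 0 ≤ k)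
    (s : {t : ℝ // 0 < t}) (ζ : ℂ) : ‖g (w + a * ζ) * Complex.exp (k * ζ)‖ ≤
      expNorm s g * Real.exp (s * ‖w‖) * Real.exp ((s * a + k) * ‖ζ‖) := by
  have h1 := norm_shift_le g (a * ζ) s w
  rw [norm_mul, Complex.norm_real, Real.norm_of_nonneg ha.le] at h1
  have h2 : ‖Complex.exp (k * ζ)‖ ≤ Real.exp (k * ‖ζ‖) := by
    rw [Complex.norm_exp, Complex.re_ofReal_mul]
    gcongr
    exact Complex.re_le_norm ζ
  rw [norm_mul]
  refine (mul_le_mul h1 h2 (norm_nonneg _) ((norm_nonneg _).trans h1)).trans (le_of_eq ?_)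
  have : Real.exp ((s * a + k) * ‖ζ‖) = Real.exp (s * (a * ‖ζ‖)) * Real.exp (k * ‖ζ‖) := by
    rw [← Real.exp_add]; ring_nf
  rw [this]
  ring

/-- In the variable `u = (x + Re α)/Im α` the two shifts of `g` are `w + (Im α)(u ∓ i)` with `w = z
+ β - α`. The tilt `exp(ku)`, continued to `u ∓ i`, produces the coefficients `α` and `-β` up to a
common factor, so the contour identity applies with `H(0) = g(w)`. -/
theorem meixnerDensity_integral (h0 : 0 ≤ α.re) (hi : 0 < α.im) (g : EMin) (z : ℂ) :
    Integrable (fun x : ℝ => (meixnerDensity α x : ℂ) *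
      ((α * g (z + x + (2 * (starRingEnd ℂ) α - α))
        - (starRingEnd ℂ) α * g (z + x + (starRingEnd ℂ) α)) / (α - (starRingEnd ℂ) α))) ∧
    ∫ x : ℝ, (meixnerDensity α x : ℂ) *
      ((α * g (z + x + (2 * (starRingEnd ℂ) α - α))
        - (starRingEnd ℂ) α * g (z + x + (starRingEnd ℂ) α)) / (α - (starRingEnd ℂ) α))
      = g (z + ((starRingEnd ℂ) α - α)) := by
  have hα : α ≠ 0 := fun h => by simp [h] at hi
  have hr' : (‖α‖ : ℂ) ≠ 0 := Complex.ofReal_ne_zero.mpr (norm_ne_zero_iff.mpr hα)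
  have hi' : (α.im : ℂ) ≠ 0 := Complex.ofReal_ne_zero.mpr hi.ne'
  have hθ := arg_pos_of_im_pos hi
  have hθ' : α.arg ≤ Real.pi / 2 := (abs_le.mp (Complex.abs_arg_le_pi_div_two_iff.mpr h0)).2
  set k : ℝ := Real.pi / 2 - α.arg with hk
  set w : ℂ := z + ((starRingEnd ℂ) α - α) with hw
  set H : ℂ → ℂ := fun ζ => g (w + α.im * ζ) * Complex.exp (k * ζ) with hHdef
  -- With this index the growth rate of `H` is `arg α / 2 + k = π/2 - arg α / 2`, strictly below
  -- `π/2`.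
  have hs : 0 < α.arg / 2 / α.im := by positivity
  have hHd : Differentiable ℂ H := by
    have := g.differentiable
    fun_prop
  obtain ⟨hint, hval⟩ := integral_horizontal_eq hHd
    (c := (⟨_, hs⟩ : {t : ℝ // 0 < t}) * α.im + k) (by simp only; rw [div_mul_cancel₀ _ hi.ne']; linarith)
    (by simp only; rw [div_mul_cancel₀ _ hi.ne']; linarith)
    (norm_shift_mul_exp_le g w hi (by linarith) ⟨_, hs⟩)
  have hconj : (starRingEnd ℂ) α = α.re - α.im * Complex.I := by apply Complex.ext <;> simp
  have hα' : α = α.re + α.im * Complex.I := (Complex.re_add_im α).symm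
  set G : ℝ → ℂ := fun u => (H (u - Complex.I) + H (u + Complex.I)) *
    (((Real.cosh (Real.pi / 2 * u))⁻¹ : ℝ) : ℂ) with hG
  have hpt : ∀ x : ℝ, (meixnerDensity α x : ℂ) *
      ((α * g (z + x + (2 * (starRingEnd ℂ) α - α))
        - (starRingEnd ℂ) α * g (z + x + (starRingEnd ℂ) α)) / (α - (starRingEnd ℂ) α))
      = (4 * α.im : ℂ)⁻¹ * G ((x + α.re) / α.im) := by
    intro x
    have em : w + α.im * ((((x + α.re) / α.im : ℝ) : ℂ) - Complex.I)
        = z + x + (2 * (starRingEnd ℂ) α - α) := by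
      rw [hw, hconj]
      push_cast
      field_simp
      ring
    have ep : w + α.im * ((((x + α.re) / α.im : ℝ) : ℂ) + Complex.I)
        = z + x + (starRingEnd ℂ) α := by
      rw [hw, hconj]
      push_cast
      field_simp
      linear_combination -hα'
    have hden : α - (starRingEnd ℂ) α = 2 * α.im * Complex.I := by
      rw [hconj]
      linear_combination hα'
    have h1 : Complex.exp (k * ((((x + α.re) / α.im : ℝ) : ℂ) - Complex.I))
        = Complex.exp (k * (((x + α.re) / α.im : ℝ) : ℂ))
          * ((α.im - α.re * Complex.I) / ‖α‖) := by
      rw [← exp_neg_pi_div_two_sub_arg_mul_I hα, ← Complex.exp_add, ← hk]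
      ring_nf
    have h2 : Complex.exp (k * ((((x + α.re) / α.im : ℝ) : ℂ) + Complex.I))
        = Complex.exp (k * (((x + α.re) / α.im : ℝ) : ℂ))
          * ((α.im + α.re * Complex.I) / ‖α‖) := by
      rw [← exp_pi_div_two_sub_arg_mul_I hα, ← Complex.exp_add, ← hk]
      ring_nf
    -- Thus `exp(-ik) = -iα/|α|` and `exp(ik) = i conj(α)/|α|`, the source of the coefficients `α`
    -- and `-conj α`.
    have hI : α.im - α.re * Complex.I = -Complex.I * α := by
      linear_combination Complex.I * hα' + α.im * Complex.I_sq
    have hI' : α.im + α.re * Complex.I = Complex.I * (starRingEnd ℂ) α := by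
      rw [hconj]
      linear_combination α.im * Complex.I_sq
    simp only [hG, hHdef]
    rw [em, ep, h1, h2, hI, hI', hden, meixnerDensity, ← hk]
    push_cast
    generalize (Complex.cosh _)⁻¹ = C
    field_simp
    linear_combination 4 * C * (α * g (z + x + (2 * (starRingEnd ℂ) α - α))
      - (starRingEnd ℂ) α * g (z + x + (starRingEnd ℂ) α)) * Complex.I_sq
  have hint' := ((hint.comp_div hi.ne').comp_add_right α.re).const_mul (4 * α.im : ℂ)⁻¹
  simp only [hpt]
  refine ⟨hint', ?_⟩
  rw [integral_const_mul, integral_add_right_eq_self (fun y : ℝ => G (y / α.im)) α.re,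
    Measure.integral_comp_div, hval, abs_of_pos hi, Complex.real_smul]
  simp only [hHdef, mul_zero, add_zero, Complex.exp_zero, mul_one]
  field_simp

theorem meixnerLaw_formula (h0 : 0 ≤ α.re) (hi : 0 < α.im) {β : ℂ} (hβ : β = (starRingEnd ℂ) α)
    (g : EMin) (z : ℂ) :
    Integrable (fun x : ℝ => (1 - α • hDeriv (β - α)) g (z + x + β) * (α / β)
        - (1 - α • hDeriv (β - α)) g z * ((α - β) / β)) (meixnerLaw α (‖α‖ ^ 2)) ∧
      g z = ∫ x : ℝ, ((1 - α • hDeriv (β - α)) g (z + x + β) * (α / β)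
        - (1 - α • hDeriv (β - α)) g z * ((α - β) / β)) ∂(meixnerLaw α (‖α‖ ^ 2)) := by
  have hα : α ≠ 0 := fun h => by simp [h] at hi
  have hβ0 : β ≠ 0 := by rw [hβ]; simpa using hα
  have hδ : α - β ≠ 0 := fun h => by
    have := congrArg Complex.im h
    rw [hβ] at this
    simp at this
    linarith
  have hδ' : β - α ≠ 0 := by rw [← neg_sub]; exact neg_ne_zero.mpr hδ
  set f := (1 - α • hDeriv (β - α)) g with hf
  have hfg : ∀ w, f w = (α * g (w + (β - α)) - β * g w) / (α - β) := by
    intro w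
    have : f w = g w - α * hDeriv (β - α) g w := rfl
    rw [this, hDeriv_apply hδ', ← neg_sub α β]
    field_simp
    ring
  obtain ⟨h1, h2⟩ := meixnerDensity_integral h0 hi g z
  -- The case `g = 1` says that the density has total mass one; it handles the constant term
  -- `f(z)(α-β)/β`.
  obtain ⟨h3, h4⟩ := meixnerDensity_integral h0 hi (ofPoly 1) 0
  simp only [← hβ, ofPoly_apply, eval_one, mul_one, div_self hδ] at h1 h2 h3 h4
  have h5 : ∀ x : ℝ, (meixnerDensity α x : ℂ) * (f (z + x + β) * (α / β) - f z * ((α - β) / β))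
      = (meixnerDensity α x : ℂ) *
        ((α * g (z + x + (2 * β - α)) - β * g (z + x + β)) / (α - β)) * (α / β)
        - (meixnerDensity α x : ℂ) * (f z * ((α - β) / β)) := by
    intro x
    rw [hfg (z + x + β), show z + x + β + (β - α) = z + x + (2 * β - α) by ring]
    ring
  rw [meixnerLaw_norm_sq hi, integrable_withDensity_ofReal_iff (measurable_meixnerDensity α)
    (meixnerDensity_nonneg α), integral_withDensity_ofReal (measurable_meixnerDensity α)
    (meixnerDensity_nonneg α)]
  simp only [h5]
  refine ⟨(h1.mul_const _).sub (h3.mul_const _), ?_⟩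
  rw [integral_sub (h1.mul_const _) (h3.mul_const _), integral_mul_const, integral_mul_const, h2,
    h4, hfg z]
  field_simp
  ring

end Meixner

end SegalBargmann

theorem mainTheorem8 :
    -- gamma case `α = β > 0`, with `l = σ/α`, `η = α²`; `D_{β-α} = D_0 = D`
    (∀ α σ : ℝ, 0 < α → 0 < σ →
      ∃ V : EMin →L[ℂ] EMin,
        (∀ W : EMin →L[ℂ] EMin, ExtendsV α α σ (σ / α) W ↔ W = V) ∧
        V * (1 - (α : ℂ) • EMin.hDeriv 0) = 1 ∧
        (1 - (α : ℂ) • EMin.hDeriv 0) * V = 1 ∧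
        ∀ (f : EMin) (z : ℂ),
          Integrable (fun x : ℝ => f (z + x)) (gammaLaw α (α ^ 2)) ∧
          V f z = ∫ x : ℝ, f (z + x) ∂(gammaLaw α (α ^ 2))) ∧
    -- negative binomial case `α > β > 0`, with `l = σ/α`, `η = αβ`
    (∀ α β σ : ℝ, 0 < β → β < α → 0 < σ →
      ∃ V : EMin →L[ℂ] EMin,
        (∀ W : EMin →L[ℂ] EMin, ExtendsV α β σ (σ / α) W ↔ W = V) ∧
        V * (1 - (α : ℂ) • EMin.hDeriv (β - α)) = 1 ∧
        (1 - (α : ℂ) • EMin.hDeriv (β - α)) * V = 1 ∧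
        ∀ (f : EMin) (z : ℂ),
          Integrable (fun x : ℝ => f (z + x) * (α / β) - f z * ((α - β) / β))
            (negBinomialLaw α β (α * β)) ∧
          V f z = ∫ x : ℝ, (f (z + x) * (α / β) - f z * ((α - β) / β))
            ∂(negBinomialLaw α β (α * β))) ∧
    -- Meixner case `Re α ≥ 0`, `Im α > 0`, `β = conj α`, with `l = 0`, `η = αβ = |α|²`
    (∀ (α β : ℂ) (σ : ℝ), 0 ≤ α.re → 0 < α.im → β = (starRingEnd ℂ) α → 0 < σ →
      ∃ V : EMin →L[ℂ] EMin,
        (∀ W : EMin →L[ℂ] EMin, ExtendsV α β σ 0 W ↔ W = V) ∧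
        V * (1 - α • EMin.hDeriv (β - α)) = 1 ∧
        (1 - α • EMin.hDeriv (β - α)) * V = 1 ∧
        ∀ (f : EMin) (z : ℂ),
          Integrable (fun x : ℝ => f (z + x + β) * (α / β) - f z * ((α - β) / β))
            (meixnerLaw α (‖α‖ ^ 2)) ∧
          V f z = ∫ x : ℝ, (f (z + x + β) * (α / β) - f z * ((α - β) / β))
            ∂(meixnerLaw α (‖α‖ ^ 2))) := by
  refine ⟨fun α σ hα _ => ?_, fun α β σ hβ hβα _ => ?_, fun α β σ h0 hi hβ _ => ?_⟩
  · have h := EMin.exists_extension_of_forall α α σ (σ / α)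
      (fun f z v => Integrable (fun x : ℝ => f (z + x)) (gammaLaw α (α ^ 2)) ∧
        v = ∫ x : ℝ, f (z + x) ∂(gammaLaw α (α ^ 2)))
      -- The general reduction produces `D_{α-α}`, which `sub_self` turns into `D_0`.
      (by rw [sub_self]; exact gammaLaw_formula hα)
    rwa [sub_self] at h
  · exact EMin.exists_extension_of_forall α β σ (σ / α)
      (fun f z v => Integrable (fun x : ℝ => f (z + x) * (α / β) - f z * ((α - β) / β))
          (negBinomialLaw α β (α * β)) ∧
        v = ∫ x : ℝ, (f (z + x) * (α / β) - f z * ((α - β) / β)) ∂(negBinomialLaw α β (α * β)))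
      (negBinomialLaw_formula hβ hβα)
  · exact EMin.exists_extension_of_forall α β σ 0
      (fun f z v => Integrable (fun x : ℝ => f (z + x + β) * (α / β) - f z * ((α - β) / β))
          (meixnerLaw α (‖α‖ ^ 2)) ∧
        v = ∫ x : ℝ, (f (z + x + β) * (α / β) - f z * ((α - β) / β)) ∂(meixnerLaw α (‖α‖ ^ 2)))
      (meixnerLaw_formula h0 hi hβ)
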